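/- Let $\mathbb{H}$ be the real quaternions, $\mathbb{B}=\{q\in\mathbb{H}:|q|<1\}$ and $\mathbb{S}=\{I\in\mathbb{H}: I^2=-1\}$. A function $f:\mathbb{B}\to\mathbb{H}$ is slice regular if, for every $I\in\mathbb{S}$, its restriction $f_I$ to $\mathbb{B}\cap(\mathbb{R}+\mathbb{R}I)$ has continuous partial derivatives and satisfies $\frac12\left(\frac{\partial}{\partial x}+I\frac{\partial}{\partial y}\right)f_I(x+yI)=0$. Its slice derivative $f'$ is given by $f'(x+yI)=\frac12\left(\frac{\partial}{\partial x}-I\frac{\partial}{\partial y}\right)f_I(x+yI)$ for all $I\in\mathbb{S}$. Every slice regular function on $\mathbb{B}$ has an expansion $f(q)=\sum_{n\ge0}q^na_n$ with $a_n=f^{(n)}(0)/n!$, where $f^{(n)}$ is the $n$-th slice derivative. For $f(q)=\sum_n q^na_n$ and $g(q)=\sum_n q^nb_n$ put $(f*g)(q)=\sum_n q^n\sum_{k=0}^n a_kb_{n-k}$, $f^c(q)=\sum_n q^n\overline{a_n}$, $f^s=f*f^c$ and, where $f^s(q)\neq0$, $f^{-*}(q)=f^s(q)^{-1}f^c(q)$;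 write $f^{-*2}=f^{-*}*f^{-*}$. Let $\mathcal{S}^*$ be the class of slice regular functions $h$ on $\mathbb{B}$ whose zero set in $\mathbb{B}$ is $\{0\}$, with $h'(0)=1$ and $$\operatorname{Re}\big(h(q)^{-1}q\,h'(q)\big)>0\quad\text{for all } q\in\mathbb{B}\setminus\{0\}.$$ Let $\mathcal{C}$ be the class of slice regular functions $f$ on $\mathbb{B}$ for which there is $h\in\mathcal{S}^*$ with $$\operatorname{Re}\big(h(q)^{-1}q\,f'(q)\big)>0\quad\text{for all } q\in\mathbb{B}\setminus\{0\}.$$ **Theorem.** Let $f(q)=q+\sum_{n=2}^{\infty}q^na_n$ ($q\in\mathbb{B}$) belong to $\mathcal{C}$. Then $|a_n|\le n$ for all $n\ge2$. Moreover, for each given $n\ge2$, equality $|a_n|=n$ holds if and only if there is $u\in\mathbb{H}$ with $|u|=1$ such that $$f(q)=q(1-qu)^{-*2}\quad\text{for all } q\in\mathbb{B}.$$ -/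

import Mathlib

open scoped Quaternion

noncomputable section

namespace SliceReg

/-- The open unit ball of the quaternions. -/
def unitBall : Set ℍ[ℝ] := Metric.ball 0 1

/-- The sphere of imaginary units. -/
def imagUnits : Set ℍ[ℝ] := {I | I ^ 2 = -1}

/-- The point `x + yI` of the plane `ℂ_I`, for `z = x + iy`. -/
def slicePoint (I : ℍ[ℝ]) (z : ℂ) : ℍ[ℝ] := (z.re : ℍ[ℝ]) + (z.im : ℍ[ℝ]) * I

/-- The restriction `f_I` of `f` to the plane `ℂ_I`, as a function of `x + iy`. -/
def sliceRestrict (f : ℍ[ℝ] → ℍ[ℝ]) (I : ℍ[ℝ]) (z : ℂ) : ℍ[ℝ] := f (slicePoint I z)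

/-- The partial derivative `∂f_I/∂x`. -/
def partialX (f : ℍ[ℝ] → ℍ[ℝ]) (I : ℍ[ℝ]) (z : ℂ) : ℍ[ℝ] :=
  fderiv ℝ (sliceRestrict f I) z 1

/-- The partial derivative `∂f_I/∂y`. -/
def partialY (f : ℍ[ℝ] → ℍ[ℝ]) (I : ℍ[ℝ]) (z : ℂ) : ℍ[ℝ] :=
  fderiv ℝ (sliceRestrict f I) z Complex.I

/-- (Left) slice regularity on an open set `Ω`: for every imaginary unit `I` the restriction `f_I`
to `Ω ∩ ℂ_I` is continuously differentiable and satisfies `(1/2)(∂/∂x + I ∂/∂y) f_I = 0`. -/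
def SliceRegularOn (f : ℍ[ℝ] → ℍ[ℝ]) (Ω : Set ℍ[ℝ]) : Prop :=
  ∀ I ∈ imagUnits,
    ContDiffOn ℝ 1 (sliceRestrict f I) {z | slicePoint I z ∈ Ω} ∧
    ∀ z : ℂ, slicePoint I z ∈ Ω → (1 / 2 : ℝ) • (partialX f I z + I * partialY f I z) = 0

/-- The `I`-derivative `(1/2)(∂/∂x - I ∂/∂y) f_I` at `x + yI`, where `z = x + iy`. -/
def derivI (f : ℍ[ℝ] → ℍ[ℝ]) (I : ℍ[ℝ]) (z : ℂ) : ℍ[ℝ] :=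
  (1 / 2 : ℝ) • (partialX f I z - I * partialY f I z)

/-- The basis quaternion `i`. -/
def basisI : ℍ[ℝ] := ⟨0, 1, 0, 0⟩

open Classical in
/-- An imaginary unit `I` with `q ∈ ℂ_I`: `Im q / |Im q|`, or `i` if `q` is real. -/
def unitOf (q : ℍ[ℝ]) : ℍ[ℝ] := if q.im = 0 then basisI else ‖q.im‖⁻¹ • q.im

/-- The slice derivative `f'`, equal to the `I`-derivative of `f` on every `ℂ_I`. For slice regular
`f` the choice of `I` is immaterial: see `sliceDeriv_slicePoint`. -/
def sliceDeriv (f : ℍ[ℝ] → ℍ[ℝ]) (q : ℍ[ℝ]) : ℍ[ℝ] := derivI f (unitOf q) ⟨q.re, ‖q.im‖⟩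

/-- The coefficient `f⁽ⁿ⁾(0) / n!` of the expansion `f(q) = ∑ qⁿ aₙ`. -/
def taylorCoeff (f : ℍ[ℝ] → ℍ[ℝ]) (n : ℕ) : ℍ[ℝ] :=
  ((n.factorial : ℝ)⁻¹) • (sliceDeriv^[n] f) 0

/-- The regular product `(f * g)(q) = ∑ qⁿ (∑_{k ≤ n} a_k b_{n-k})`. -/
def regMul (f g : ℍ[ℝ] → ℍ[ℝ]) (q : ℍ[ℝ]) : ℍ[ℝ] :=
  ∑' n : ℕ, q ^ n * ∑ k ∈ Finset.range (n + 1), taylorCoeff f k * taylorCoeff g (n - k)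

/-- The regular conjugate `f^c(q) = ∑ qⁿ conj(a_n)`. -/
def regConj (f : ℍ[ℝ] → ℍ[ℝ]) (q : ℍ[ℝ]) : ℍ[ℝ] := ∑' n : ℕ, q ^ n * star (taylorCoeff f n)

/-- The symmetrization `f^s = f * f^c`. -/
def symmetrization (f : ℍ[ℝ] → ℍ[ℝ]) : ℍ[ℝ] → ℍ[ℝ] := regMul f (regConj f)

/-- The regular reciprocal `f^{-*}(q) = f^s(q)⁻¹ f^c(q)`. -/
def regInv (f : ℍ[ℝ] → ℍ[ℝ]) (q : ℍ[ℝ]) : ℍ[ℝ] := (symmetrization f q)⁻¹ * regConj f q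

/-- The function `q (1 - qu)^{-*2}`, where `g^{-*2} = g^{-*} * g^{-*}`. -/
def koebe (u q : ℍ[ℝ]) : ℍ[ℝ] :=
  q * regMul (regInv fun p => 1 - p * u) (regInv fun p => 1 - p * u) q

/-- The class `𝒮`: slice regular on the unit ball, with zero set `{0}` there, and `f'(0) = 1`. -/
def ClassS (f : ℍ[ℝ] → ℍ[ℝ]) : Prop :=
  SliceRegularOn f unitBall ∧ {q ∈ unitBall | f q = 0} = {0} ∧ sliceDeriv f 0 = 1

/-- The class `𝒮*`. The quotient `f(q)⁻¹ q f'(q)` is not defined at `q = 0` (where its limit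
is `1`). -/
def ClassSStar (f : ℍ[ℝ] → ℍ[ℝ]) : Prop :=
  ClassS f ∧ ∀ q ∈ unitBall, q ≠ 0 → 0 < ((f q)⁻¹ * (q * sliceDeriv f q)).re

/-- The class `𝒞`. -/
def ClassC (f : ℍ[ℝ] → ℍ[ℝ]) : Prop :=
  SliceRegularOn f unitBall ∧ ∃ h : ℍ[ℝ] → ℍ[ℝ], ClassSStar h ∧
    ∀ q ∈ unitBall, q ≠ 0 → 0 < ((h q)⁻¹ * (q * sliceDeriv f q)).re

theorem derivI_neg (f : ℍ[ℝ] → ℍ[ℝ]) (I : ℍ[ℝ]) (z : ℂ) :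
    derivI f (-I) z = derivI f I (star z) := by
  have h : sliceRestrict f (-I) = sliceRestrict f I ∘ Complex.conjCLE := by
    funext w
    simp [sliceRestrict, slicePoint]
  have hd : fderiv ℝ (sliceRestrict f (-I)) z =
      (fderiv ℝ (sliceRestrict f I) (star z)).comp
        (Complex.conjCLE : ℂ →L[ℝ] ℂ) := by
    rw [h, Complex.conjCLE.comp_right_fderiv]
    rfl
  simp [derivI, partialX, partialY, hd]

theorem derivI_eq_partialX {f : ℍ[ℝ] → ℍ[ℝ]} {Ω : Set ℍ[ℝ]}
    (hf : SliceRegularOn f Ω) {I : ℍ[ℝ]} (hI : I ∈ imagUnits) {z : ℂ}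
    (hz : slicePoint I z ∈ Ω) : derivI f I z = partialX f I z := by
  have h := (hf I hI).2 z hz
  have h' : I * partialY f I z = -partialX f I z := by
    rw [smul_eq_zero] at h
    rcases h with h | h
    · norm_num at h
    · exact eq_neg_of_add_eq_zero_right h
  rw [derivI, h', sub_neg_eq_add, ← two_smul ℝ, smul_smul]
  norm_num

theorem continuous_slicePoint (I : ℍ[ℝ]) : Continuous (slicePoint I) := by
  unfold slicePoint
  exact (Quaternion.continuous_coe.comp Complex.continuous_re).add
    ((Quaternion.continuous_coe.comp Complex.continuous_im).mul continuous_const)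

theorem partialX_eq_lineDeriv {f : ℍ[ℝ] → ℍ[ℝ]} {Ω : Set ℍ[ℝ]} (hΩ : IsOpen Ω)
    (hf : SliceRegularOn f Ω) {I : ℍ[ℝ]} (hI : I ∈ imagUnits) {z : ℂ}
    (hz : slicePoint I z ∈ Ω) : partialX f I z = lineDeriv ℝ (sliceRestrict f I) z 1 := by
  have ho : IsOpen {z | slicePoint I z ∈ Ω} := hΩ.preimage (continuous_slicePoint I)
  have hd := ((hf I hI).1.differentiableOn one_ne_zero).differentiableAt (ho.mem_nhds hz)
  exact hd.lineDeriv_eq_fderiv.symm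

theorem re_norm_of_mem_imagUnits {I : ℍ[ℝ]} (hI : I ∈ imagUnits) : I.re = 0 ∧ ‖I‖ = 1 := by
  have hI' : I ^ 2 = -1 := hI
  have hn : ‖I‖ = 1 := by
    have h := congrArg norm hI'
    rw [norm_pow, norm_neg, norm_one] at h
    exact (pow_eq_one_iff_of_nonneg (norm_nonneg I) two_ne_zero).1 h
  refine ⟨?_, hn⟩
  have h1 := congrArg QuaternionAlgebra.re hI'
  have h2 : Quaternion.normSq I = 1 := by
    rw [Quaternion.normSq_eq_norm_mul_self, hn, one_mul]
  rw [Quaternion.normSq_def'] at h2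
  rw [pow_two] at h1
  simp at h1
  nlinarith [h1, h2]

theorem basisI_mem_imagUnits : basisI ∈ imagUnits := by
  have h0 : basisI.re = 0 := rfl
  have h1 : basisI.imI = 1 := rfl
  have h2 : basisI.imJ = 0 := rfl
  have h3 : basisI.imK = 0 := rfl
  change basisI ^ 2 = -1
  rw [pow_two]
  ext <;> simp [h0, h1, h2, h3]

/-- The slice derivative is the `I`-derivative on every plane `ℂ_I`. -/
theorem sliceDeriv_slicePoint {f : ℍ[ℝ] → ℍ[ℝ]} {Ω : Set ℍ[ℝ]} (hΩ : IsOpen Ω)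
    (hf : SliceRegularOn f Ω) {I : ℍ[ℝ]} (hI : I ∈ imagUnits) {z : ℂ}
    (hz : slicePoint I z ∈ Ω) : sliceDeriv f (slicePoint I z) = derivI f I z := by
  obtain ⟨hre, hn⟩ := re_norm_of_mem_imagUnits hI
  have hI0 : I ≠ 0 := by
    rintro rfl
    simp at hn
  have h1 : (slicePoint I z).re = z.re := by simp [slicePoint, hre]
  have h2 : (slicePoint I z).im = z.im • I := by
    ext <;> simp [slicePoint, hre]
  rw [sliceDeriv, h1, h2, norm_smul, hn, mul_one, Real.norm_eq_abs]
  rcases lt_trichotomy z.im 0 with hy | hy | hy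
  · have hu : unitOf (slicePoint I z) = -I := by
      rw [unitOf, h2, if_neg (smul_ne_zero hy.ne hI0), norm_smul, hn, mul_one, Real.norm_eq_abs,
        abs_of_neg hy, smul_smul, inv_neg, neg_mul, inv_mul_cancel₀ hy.ne, neg_one_smul]
    rw [hu, derivI_neg, abs_of_neg hy]
    congr 1
    apply Complex.ext <;> simp
  · have hu : unitOf (slicePoint I z) = basisI := by
      rw [unitOf, h2, hy, zero_smul, if_pos rfl]
    have hi : basisI ∈ imagUnits := basisI_mem_imagUnits
    have hzz : (⟨z.re, |z.im|⟩ : ℂ) = z := by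
      apply Complex.ext <;> simp [hy]
    have hp : ∀ J : ℍ[ℝ], ∀ t : ℝ, slicePoint J (z + t • 1) = ((z.re + t : ℝ) : ℍ[ℝ]) := by
      intro J t
      simp [slicePoint, hy]
    have hp0 : ∀ J : ℍ[ℝ], slicePoint J z = (z.re : ℍ[ℝ]) := by
      intro J
      simp [slicePoint, hy]
    have hz' : slicePoint basisI z ∈ Ω := by
      rw [hp0, ← hp0 I]
      exact hz
    rw [hu, hzz, derivI_eq_partialX hf hi hz', derivI_eq_partialX hf hI hz,
      partialX_eq_lineDeriv hΩ hf hi hz', partialX_eq_lineDeriv hΩ hf hI hz]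
    simp only [lineDeriv, sliceRestrict, hp]
  · have hu : unitOf (slicePoint I z) = I := by
      rw [unitOf, h2, if_neg (smul_ne_zero hy.ne' hI0), norm_smul, hn, mul_one, Real.norm_eq_abs,
        abs_of_pos hy, smul_smul, inv_mul_cancel₀ hy.ne', one_smul]
    rw [hu, abs_of_pos hy]

end SliceReg

end

open scoped Quaternion
open PowerSeries
open Finset.HasAntidiagonal (antidiagonal mem_antidiagonal)

noncomputable section

namespace SliceReg

/-! Every slice regular function on the ball is a power series with right coefficients, so the
problem becomes one about coefficients. Write `h = q k`, with `k` zero-free and `k(0) = 1`; the two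
hypotheses then say that `k(q)⁻¹ h'(q)` and `k(q)⁻¹ f'(q)` have positive real part. These pointwise
quotients are not regular. The regular quotient `g` with `f' = k * g` is, and the product formula
`(k * g)(q) = k(q) g(k(q)⁻¹ q k(q))` shows that the pointwise quotient at `q` is the value of `g` at
a conjugate of `q`. Since `q ↦ k(q)⁻¹ q k(q)` maps the ball onto itself (a right inverse comes from
the conjugate series of `k`), `g` has positive real part everywhere. This is
`exists_regular_quotient`; applied to `h'` it gives `h' = k * p`.

Carathéodory's bound `|p_n| ≤ 2` (`norm_coeff_le_two`) follows from the complex one by projecting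
the coefficients to a plane `ℂ_I` containing `p_n`. Comparing coefficients, `n k_n = ∑_{i<n} k_i
p_{n-i}` yields `|k_n| ≤ n + 1`, and `(n+1) a_{n+1} = ∑_{i≤n} k_i g_{n-i}` yields `|a_{n+1}| ≤ n +
1`.

Equality for a single index forces `|g_1| = |p_1| = 2`. The rigidity in Carathéodory's bound
(`coeff_eq_of_norm_coeff_one`) gives `g_j = 2u^j` and `p_j = 2v^j` for `j ≥ 1`, hence `k_n =
(n+1)v^n`. Equality in the triangle inequality gives `u = v`, and the coefficients `n u^{n-1}` are
those of the Koebe function. -/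

/-- The coefficients of `φ` are absolutely summable against `rⁿ` for every `r < 1`. -/
def DiscSummable {E : Type*} [NormedDivisionRing E] (φ : E⟦X⟧) : Prop :=
  ∀ r : ℝ, 0 ≤ r → r < 1 → Summable fun n => ‖coeff n φ‖ * r ^ n

/-- The sum of the power series `∑ qⁿ aₙ` with coefficients on the right. -/
def leftEval {E : Type*} [NormedDivisionRing E] (φ : E⟦X⟧) (q : E) : E :=
  ∑' n, q ^ n * coeff n φ

theorem hasSum_of_eq {ι E : Type*} [AddCommMonoid E] [TopologicalSpace E] {f g : ι → E} {a : E}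
    (h : HasSum f a) (e : ∀ i, g i = f i) : HasSum g a := by
  rwa [funext e]

/-! ### Power series with right coefficients: convergence and evaluation of products -/

section General

variable {E : Type*} [NormedDivisionRing E]

/-- For `r < s < 1` the polynomial factor is absorbed by `(r/s)ⁿ`. -/
theorem discSummable_of_norm_le {φ : E⟦X⟧} {a : ℕ → ℝ} (k : ℕ)
    (ha : ∀ r : ℝ, 0 ≤ r → r < 1 → Summable fun n => a n * r ^ n) (ha0 : ∀ n, 0 ≤ a n)
    (h : ∀ n, ‖coeff n φ‖ ≤ (n : ℝ) ^ k * a n) : DiscSummable φ := by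
  intro r hr0 hr1
  obtain ⟨s, hrs, hs1⟩ := exists_between hr1
  have hs0 : 0 < s := hr0.trans_lt hrs
  have hsum := ha s hs0.le hs1
  have hg : Summable fun n : ℕ => (n : ℝ) ^ k * (r / s) ^ n :=
    summable_pow_mul_geometric_of_norm_lt_one k
      (by rw [Real.norm_of_nonneg (by positivity)]; exact (div_lt_one hs0).2 hrs)
  have hb := hg.tendsto_atTop_zero.bddAbove_range
  obtain ⟨C, hC⟩ := hb
  refine Summable.of_nonneg_of_le (fun n => by positivity) (fun n => ?_) (hsum.mul_left C)
  have h1 : (n : ℝ) ^ k * (r / s) ^ n ≤ C := hC ⟨n, rfl⟩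
  have h2 : r ^ n = (r / s) ^ n * s ^ n := by
    rw [← mul_pow, div_mul_cancel₀ _ hs0.ne']
  calc ‖coeff n φ‖ * r ^ n ≤ ((n : ℝ) ^ k * a n) * r ^ n := by
        gcongr; exact h n
    _ = ((n : ℝ) ^ k * (r / s) ^ n) * (a n * s ^ n) := by rw [h2]; ring
    _ ≤ C * (a n * s ^ n) := by
        have := ha0 n
        gcongr

/-- Abel's lemma: convergence at one point of norm `s > r` bounds the terms there, and the ratio
`(r/s)ⁿ` supplies geometric decay. -/
theorem discSummable_of_summable {φ : E⟦X⟧}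
    (h : ∀ r : ℝ, 0 ≤ r → r < 1 → ∃ q : E, ‖q‖ = r ∧ Summable fun n => q ^ n * coeff n φ) :
    DiscSummable φ := by
  intro r hr0 hr1
  obtain ⟨s, hrs, hs1⟩ := exists_between hr1
  have hs0 : 0 < s := hr0.trans_lt hrs
  obtain ⟨q, hq, hsum⟩ := h s hs0.le hs1
  obtain ⟨C, hC⟩ := hsum.tendsto_atTop_zero.norm.bddAbove_range
  have hg : Summable fun n : ℕ => (r / s) ^ n :=
    summable_geometric_of_lt_one (by positivity) ((div_lt_one hs0).2 hrs)
  refine Summable.of_nonneg_of_le (fun n => by positivity) (fun n => ?_) (hg.mul_left C)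
  have h1 : ‖q ^ n * coeff n φ‖ ≤ C := hC ⟨n, rfl⟩
  rw [norm_mul, norm_pow, hq] at h1
  calc ‖coeff n φ‖ * r ^ n = (s ^ n * ‖coeff n φ‖) * (r / s) ^ n := by
        rw [div_pow]; field_simp
    _ ≤ C * (r / s) ^ n := by gcongr

theorem DiscSummable.norm {φ : E⟦X⟧} (h : DiscSummable φ) {q : E} (hq : ‖q‖ < 1) :
    Summable fun n => ‖q ^ n * coeff n φ‖ := by
  refine (h ‖q‖ (norm_nonneg q) hq).congr fun n => ?_
  rw [norm_mul, norm_pow, mul_comm]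

theorem DiscSummable.mul {φ ψ : E⟦X⟧} (hφ : DiscSummable φ) (hψ : DiscSummable ψ) :
    DiscSummable (φ * ψ) := by
  intro r hr0 hr1
  have h1 : Summable fun n => ‖‖coeff n φ‖ * r ^ n‖ := (hφ r hr0 hr1).norm
  have h2 : Summable fun n => ‖‖coeff n ψ‖ * r ^ n‖ := (hψ r hr0 hr1).norm
  refine Summable.of_nonneg_of_le (fun n => by positivity) (fun n => ?_)
    (summable_norm_sum_mul_antidiagonal_of_summable_norm h1 h2).of_norm
  rw [coeff_mul]
  calc ‖∑ p ∈ antidiagonal n, coeff p.1 φ * coeff p.2 ψ‖ * r ^ n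
      ≤ (∑ p ∈ antidiagonal n, ‖coeff p.1 φ‖ * ‖coeff p.2 ψ‖) * r ^ n := by
        gcongr
        exact (norm_sum_le _ _).trans (Finset.sum_le_sum fun p _ => norm_mul_le _ _)
    _ = _ := by
        rw [Finset.sum_mul]
        refine Finset.sum_congr rfl fun p hp => ?_
        rw [← mem_antidiagonal.1 hp, pow_add]
        ring

theorem leftEval_zero (φ : E⟦X⟧) : leftEval φ 0 = coeff 0 φ := by
  rw [leftEval, tsum_eq_single 0]
  · simp
  · intro n hn
    simp [hn]

variable [CompleteSpace E]

theorem DiscSummable.hasSum {φ : E⟦X⟧} (h : DiscSummable φ) {q : E} (hq : ‖q‖ < 1) :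
    HasSum (fun n => q ^ n * coeff n φ) (leftEval φ q) :=
  (h.norm hq).of_norm.hasSum

/-- Evaluation of a product of power series with right coefficients. -/
theorem leftEval_mul_eq_tsum {φ ψ : E⟦X⟧} (hφ : DiscSummable φ) (hψ : DiscSummable ψ) {q : E}
    (hq : ‖q‖ < 1) :
    HasSum (fun m => q ^ m * leftEval φ q * coeff m ψ) (leftEval (φ * ψ) q) := by
  set F : ℕ × ℕ → E := fun x => q ^ (x.1 + x.2) * (coeff x.1 φ * coeff x.2 ψ) with hF
  have hFn : Summable fun x => ‖F x‖ := by
    have := (hφ.norm hq).mul_of_nonneg (hψ.norm hq) (fun _ => norm_nonneg _)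
      (fun _ => norm_nonneg _)
    refine this.congr fun x => ?_
    simp only [hF, norm_mul, norm_pow, pow_add]
    ring
  have hFs : Summable F := hFn.of_norm
  have e1 : leftEval (φ * ψ) q = ∑' x, F x := by
    have hsig : Summable (F ∘ (Finset.HasAntidiagonal.sigmaAntidiagonalEquivProd (A := ℕ))) :=
      (Equiv.summable_iff _).2 hFs
    rw [← (Finset.HasAntidiagonal.sigmaAntidiagonalEquivProd (A := ℕ)).tsum_eq]
    erw [hsig.tsum_sigma]
    refine tsum_congr fun n => ?_
    rw [coeff_mul, Finset.mul_sum, tsum_fintype]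
    change _ = ∑ b : (antidiagonal n), F b.1
    rw [Finset.sum_coe_sort (antidiagonal n) F]
    refine Finset.sum_congr rfl fun p hp => ?_
    simp only [hF]
    rw [mem_antidiagonal.1 hp]
  -- Summing the double series first over the index of `φ` leaves `q^m φ(q) b_m`; the value `φ(q)`
  -- stays between `q^m` and `b_m`.
  have hsw : HasSum (F ∘ Prod.swap) (leftEval (φ * ψ) q) := by
    rw [e1]
    exact ((Equiv.prodComm ℕ ℕ).hasSum_iff).2 hFs.hasSum
  refine hsw.prod_fiberwise fun m => ?_
  have := ((hφ.hasSum hq).mul_left (q ^ m)).mul_right (coeff m ψ)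
  refine hasSum_of_eq this fun n => ?_
  simp only [hF, Function.comp_apply, Prod.swap_prod_mk]
  rw [add_comm n m, pow_add]
  simp only [mul_assoc]

theorem leftEval_mul_of_commute {φ ψ : E⟦X⟧} (hφ : DiscSummable φ) (hψ : DiscSummable ψ) {q : E}
    (hq : ‖q‖ < 1) (hc : Commute q (leftEval φ q)) :
    leftEval (φ * ψ) q = leftEval φ q * leftEval ψ q := by
  refine (leftEval_mul_eq_tsum hφ hψ hq).unique ?_
  refine hasSum_of_eq ((hψ.hasSum hq).mul_left (leftEval φ q)) fun m => ?_
  rw [(hc.pow_left m).eq, mul_assoc]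

/-- With `c = φ(q)`, moving `c` to the left of the powers replaces `q` by its conjugate: `q^m c = c
(c⁻¹ q c)^m`. -/
theorem leftEval_mul_of_ne_zero {φ ψ : E⟦X⟧} (hφ : DiscSummable φ) (hψ : DiscSummable ψ) {q : E}
    (hq : ‖q‖ < 1) (hc : leftEval φ q ≠ 0) :
    leftEval (φ * ψ) q =
      leftEval φ q * leftEval ψ ((leftEval φ q)⁻¹ * q * leftEval φ q) := by
  set c := leftEval φ q with hc'
  have hq' : ‖c⁻¹ * q * c‖ < 1 := by
    have : ‖c‖ ≠ 0 := norm_ne_zero_iff.2 hc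
    rw [norm_mul, norm_mul, norm_inv]
    field_simp
    exact hq
  refine (leftEval_mul_eq_tsum hφ hψ hq).unique ?_
  refine hasSum_of_eq ((hψ.hasSum hq').mul_left c) fun m => ?_
  have hp : ∀ m : ℕ, c * (c⁻¹ * q * c) ^ m = q ^ m * c := by
    intro m
    induction m with
    | zero => simp
    | succ m ih =>
      rw [pow_succ, ← mul_assoc, ih, pow_succ]
      simp only [mul_assoc]
      rw [mul_inv_cancel_left₀ hc]
  rw [← mul_assoc, hp, hc']

end General

/-- Coefficients of a power series are determined by its values at small real points. -/
theorem coeff_unique {E : Type*} [NormedAddCommGroup E] [NormedSpace ℝ E] {a b : ℕ → E} {g : ℝ → E}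
    (ha : ∀ t : ℝ, |t| < 1 → HasSum (fun n => t ^ n • a n) (g t))
    (hb : ∀ t : ℝ, |t| < 1 → HasSum (fun n => t ^ n • b n) (g t)) : a = b := by
  let p : (ℕ → E) → FormalMultilinearSeries ℝ ℝ E := fun c n =>
    ContinuousMultilinearMap.mkPiRing ℝ (Fin n) (c n)
  have hp : ∀ c n, (p c).coeff n = c n := by
    intro c n
    simp [p, FormalMultilinearSeries.coeff]
  have key : ∀ c : ℕ → E, (∀ t : ℝ, |t| < 1 → HasSum (fun n => t ^ n • c n) (g t)) →
      HasFPowerSeriesAt g (p c) 0 := by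
    intro c hc
    refine hasFPowerSeriesAt_iff.2 ?_
    filter_upwards [Metric.ball_mem_nhds (0 : ℝ) one_pos] with t ht
    rw [mem_ball_zero_iff, Real.norm_eq_abs] at ht
    simpa [hp] using hc t ht
  have h := (key a ha).eq_formalMultilinearSeries (key b hb)
  funext n
  rw [← hp a n, h, hp]

/-! ### The complex planes `ℂ_I` -/

theorem mul_self_of_mem_imagUnits {I : ℍ[ℝ]} (hI : I ∈ imagUnits) : I * I = -1 := by
  rw [← pow_two]; exact hI

theorem slicePoint_eq_liftAux {I : ℍ[ℝ]} (hI : I ∈ imagUnits) (z : ℂ) :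
    slicePoint I z = Complex.liftAux I (mul_self_of_mem_imagUnits hI) z := by
  rw [Complex.liftAux_apply, slicePoint, ← Quaternion.coe_mul_eq_smul]
  rfl

theorem slicePoint_mul {I : ℍ[ℝ]} (hI : I ∈ imagUnits) (z w : ℂ) :
    slicePoint I (z * w) = slicePoint I z * slicePoint I w := by
  simp only [slicePoint_eq_liftAux hI, map_mul]

theorem slicePoint_pow {I : ℍ[ℝ]} (hI : I ∈ imagUnits) (z : ℂ) (n : ℕ) :
    slicePoint I (z ^ n) = slicePoint I z ^ n := by
  simp only [slicePoint_eq_liftAux hI, map_pow]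

theorem slicePoint_add (I : ℍ[ℝ]) (z w : ℂ) :
    slicePoint I (z + w) = slicePoint I z + slicePoint I w := by
  simp [slicePoint, add_mul]
  abel

theorem slicePoint_ofReal (I : ℍ[ℝ]) (t : ℝ) : slicePoint I t = (t : ℍ[ℝ]) := by
  simp [slicePoint]

theorem slicePoint_I (I : ℍ[ℝ]) : slicePoint I Complex.I = I := by
  simp [slicePoint]

theorem star_of_mem_imagUnits {I : ℍ[ℝ]} (hI : I ∈ imagUnits) : star I = -I :=
  Quaternion.star_eq_neg.2 (re_norm_of_mem_imagUnits hI).1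

theorem star_slicePoint {I : ℍ[ℝ]} (hI : I ∈ imagUnits) (z : ℂ) :
    star (slicePoint I z) = slicePoint I (star z) := by
  simp [slicePoint, star_of_mem_imagUnits hI, Quaternion.coe_commutes]

theorem norm_slicePoint {I : ℍ[ℝ]} (hI : I ∈ imagUnits) (z : ℂ) : ‖slicePoint I z‖ = ‖z‖ := by
  have h2 : ((‖slicePoint I z‖ * ‖slicePoint I z‖ : ℝ) : ℍ[ℝ]) = ((‖z‖ * ‖z‖ : ℝ) : ℍ[ℝ]) := by
    rw [← Quaternion.normSq_eq_norm_mul_self, ← Quaternion.self_mul_star,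
      star_slicePoint hI, ← slicePoint_mul hI,
      ← slicePoint_ofReal I]
    congr 1
    rw [← pow_two, ← Complex.normSq_eq_norm_sq, ← Complex.mul_conj]
    rfl
  exact (mul_self_inj_of_nonneg (norm_nonneg _) (norm_nonneg _)).1 (Quaternion.coe_injective h2)

theorem mem_imagUnits_of_re_norm {I : ℍ[ℝ]} (h0 : I.re = 0) (h1 : ‖I‖ = 1) : I ∈ imagUnits := by
  have h2 : I * star I = 1 := by
    rw [Quaternion.self_mul_star, Quaternion.normSq_eq_norm_mul_self, h1]; simp
  rw [Quaternion.star_eq_neg.2 h0, mul_neg] at h2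
  change I ^ 2 = -1
  rw [pow_two, ← h2, neg_neg]

theorem unitOf_mem_imagUnits (q : ℍ[ℝ]) : unitOf q ∈ imagUnits := by
  rw [unitOf]
  split_ifs with h
  · exact basisI_mem_imagUnits
  · refine mem_imagUnits_of_re_norm (by simp) ?_
    rw [norm_smul, norm_inv, norm_norm, inv_mul_cancel₀ (norm_ne_zero_iff.2 h)]

theorem slicePoint_unitOf (q : ℍ[ℝ]) : slicePoint (unitOf q) ⟨q.re, ‖q.im‖⟩ = q := by
  rw [slicePoint, unitOf, Quaternion.coe_mul_eq_smul]
  split_ifs with h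
  · conv_rhs => rw [← Quaternion.re_add_im q, h]
    simp [h]
  · rw [smul_smul, mul_inv_cancel₀ (norm_ne_zero_iff.2 h), one_smul]
    exact Quaternion.re_add_im q

theorem norm_complex_of (q : ℍ[ℝ]) : ‖(⟨q.re, ‖q.im‖⟩ : ℂ)‖ = ‖q‖ := by
  rw [← norm_slicePoint (unitOf_mem_imagUnits q), slicePoint_unitOf]

theorem exists_slicePoint (q : ℍ[ℝ]) : ∃ I ∈ imagUnits, ∃ z : ℂ, slicePoint I z = q ∧ ‖z‖ = ‖q‖ :=
  ⟨_, unitOf_mem_imagUnits q, _, slicePoint_unitOf q, norm_complex_of q⟩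

/-! ### Conjugate series, symmetrization and reciprocals -/

/-- The power series with conjugated coefficients. -/
def conjSeries (φ : ℍ[ℝ]⟦X⟧) : ℍ[ℝ]⟦X⟧ := PowerSeries.mk fun n => star (coeff n φ)

@[simp] theorem coeff_conjSeries (φ : ℍ[ℝ]⟦X⟧) (n : ℕ) :
    coeff n (conjSeries φ) = star (coeff n φ) := by
  simp [conjSeries]

theorem DiscSummable.conjSeries {φ : ℍ[ℝ]⟦X⟧} (h : DiscSummable φ) :
    DiscSummable (conjSeries φ) := by
  intro r h0 h1
  simpa using h r h0 h1

/-- On a sphere `x + y𝕊` a power series has the form `α + Iβ`, and the series with conjugated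
coefficients has the form `conj α + I conj β`. -/
theorem exists_stem {φ : ℍ[ℝ]⟦X⟧} (h : DiscSummable φ) {z : ℂ} (hz : ‖z‖ < 1) :
    ∃ α β : ℍ[ℝ], ∀ I ∈ imagUnits, leftEval φ (slicePoint I z) = α + I * β ∧
      leftEval (conjSeries φ) (slicePoint I z) = star α + I * star β := by
  have hb : ∀ c : ℕ → ℝ, (∀ n, |c n| ≤ ‖z‖ ^ n) → Summable fun n => c n • coeff n φ := by
    intro c hc
    refine Summable.of_norm_bounded (h ‖z‖ (norm_nonneg z) hz) fun n => ?_
    rw [norm_smul, mul_comm]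
    gcongr
    exact hc n
  have h1 := (hb (fun n => (z ^ n).re) fun n => by
    rw [← norm_pow]; exact Complex.abs_re_le_norm _).hasSum
  have h2 := (hb (fun n => (z ^ n).im) fun n => by
    rw [← norm_pow]; exact Complex.abs_im_le_norm _).hasSum
  -- The weights `Re zⁿ` and `Im zⁿ` are real and independent of `I`, so they commute with the
  -- coefficients and are unchanged by conjugation.
  refine ⟨∑' n, (z ^ n).re • coeff n φ, ∑' n, (z ^ n).im • coeff n φ, fun I hI => ⟨?_, ?_⟩⟩
  · have hq : ‖slicePoint I z‖ < 1 := by rwa [norm_slicePoint hI]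
    refine (h.hasSum hq).unique (hasSum_of_eq (h1.add (h2.mul_left I)) fun n => ?_)
    rw [← slicePoint_pow hI, slicePoint, add_mul, Quaternion.coe_mul_eq_smul, mul_smul_comm,
      Quaternion.coe_mul_eq_smul, smul_mul_assoc]
  · have hq : ‖slicePoint I z‖ < 1 := by rwa [norm_slicePoint hI]
    refine (h.conjSeries.hasSum hq).unique
      (hasSum_of_eq (h1.star.add (h2.star.mul_left I)) fun n => ?_)
    rw [← slicePoint_pow hI, slicePoint, add_mul, Quaternion.coe_mul_eq_smul,
      Quaternion.coe_mul_eq_smul, smul_mul_assoc, coeff_conjSeries, Quaternion.star_smul,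
      Quaternion.star_smul, mul_smul_comm]

/-- If the conjugated series has a zero in the ball, so does the series itself. -/
theorem exists_zero_of_conjSeries {φ : ℍ[ℝ]⟦X⟧} (h : DiscSummable φ) {q : ℍ[ℝ]} (hq : ‖q‖ < 1)
    (h0 : leftEval (conjSeries φ) q = 0) : ∃ p : ℍ[ℝ], ‖p‖ < 1 ∧ leftEval φ p = 0 := by
  obtain ⟨J, hJ, z, rfl, hz⟩ := exists_slicePoint q
  rw [← hz] at hq
  obtain ⟨α, β, hs⟩ := exists_stem h hq
  rw [(hs J hJ).2] at h0
  have h1 : α = β * J := by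
    have := congrArg star h0
    simp only [star_add, star_mul, star_star, star_zero, star_of_mem_imagUnits hJ, mul_neg] at this
    exact eq_of_sub_eq_zero (by rw [sub_eq_add_neg]; exact this)
  -- Now `α = βJ`, so `α + Iβ` vanishes for `I = -βJβ⁻¹`, a unit on the same sphere, unless `β = 0`,
  -- when the whole sphere consists of zeros.
  by_cases hβ : β = 0
  · refine ⟨slicePoint J z, by rwa [norm_slicePoint hJ], ?_⟩
    rw [(hs J hJ).1, h1, hβ]
    simp
  · have hI : -(β * J * β⁻¹) ∈ imagUnits := by
      change _ ^ 2 = _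
      rw [neg_sq, pow_two]
      calc β * J * β⁻¹ * (β * J * β⁻¹) = β * J * (β⁻¹ * β) * J * β⁻¹ := by
            simp only [mul_assoc]
        _ = β * (J * J) * β⁻¹ := by rw [inv_mul_cancel₀ hβ, mul_one]; simp only [mul_assoc]
        _ = -1 := by
          rw [mul_self_of_mem_imagUnits hJ, mul_neg, mul_one, neg_mul, mul_inv_cancel₀ hβ]
    refine ⟨slicePoint _ z, by rwa [norm_slicePoint hI], ?_⟩
    rw [(hs _ hI).1, h1, neg_mul, mul_assoc (β * J), inv_mul_cancel₀ hβ, mul_one, add_neg_cancel]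

/-- Conjugation exchanges the terms `(i, j)` and `(j, i)` of each coefficient `∑ a_i conj(a_j)`. -/
theorem exists_real_mul_conjSeries (φ : ℍ[ℝ]⟦X⟧) :
    ∃ σ : ℝ⟦X⟧, φ * conjSeries φ = PowerSeries.map (algebraMap ℝ ℍ[ℝ]) σ := by
  refine ⟨PowerSeries.mk fun n => (coeff n (φ * conjSeries φ)).re, ?_⟩
  ext1 n
  rw [coeff_map, coeff_mk]
  refine (Quaternion.star_eq_self.1 ?_)
  rw [coeff_mul, star_sum, ← Finset.Nat.sum_antidiagonal_swap]
  simp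

/-- Series with real coefficients are central. -/
theorem commute_map_algebraMap (σ : ℝ⟦X⟧) (φ : ℍ[ℝ]⟦X⟧) :
    Commute (PowerSeries.map (algebraMap ℝ ℍ[ℝ]) σ) φ := by
  change _ * _ = _ * _
  ext1 n
  rw [coeff_mul, coeff_mul, ← Finset.Nat.sum_antidiagonal_swap]
  refine Finset.sum_congr rfl fun p _ => ?_
  simp only [coeff_map, Prod.fst_swap, Prod.snd_swap]
  exact Algebra.commutes _ _

/-- Real coefficients preserve every plane `ℂ_I`. This reduces the inversion of a symmetrization to
complex analysis on the disc. -/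
theorem leftEval_map_algebraMap {σ : ℝ⟦X⟧} (h : DiscSummable σ) {I : ℍ[ℝ]} (hI : I ∈ imagUnits)
    {z : ℂ} (hz : ‖z‖ < 1) :
    leftEval (PowerSeries.map (algebraMap ℝ ℍ[ℝ]) σ) (slicePoint I z) =
      slicePoint I (leftEval (PowerSeries.map (algebraMap ℝ ℂ) σ) z) := by
  have h1 : DiscSummable (PowerSeries.map (algebraMap ℝ ℍ[ℝ]) σ) := by
    intro r h0 h1
    simpa using h r h0 h1
  have h2 : DiscSummable (PowerSeries.map (algebraMap ℝ ℂ) σ) := by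
    intro r h0 h1
    simpa using h r h0 h1
  let L : ℂ →+ ℍ[ℝ] := ⟨⟨slicePoint I, by simp [slicePoint]⟩, slicePoint_add I⟩
  have h3 := (h2.hasSum hz).map L (continuous_slicePoint I)
  refine (h1.hasSum (by rwa [norm_slicePoint hI])).unique (hasSum_of_eq h3 fun n => ?_)
  change _ = slicePoint I _
  rw [slicePoint_mul hI, slicePoint_pow hI, coeff_map, coeff_map]
  congr 1
  exact (slicePoint_ofReal I _).symm

theorem leftEval_differentiableOn {φ : ℂ⟦X⟧} (h : DiscSummable φ) :
    DifferentiableOn ℂ (leftEval φ) (Metric.ball 0 1) := by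
  intro z hz
  rw [mem_ball_zero_iff] at hz
  obtain ⟨r, hzr, hr1⟩ := exists_between hz
  have hr0 : 0 ≤ r := (norm_nonneg z).trans hzr.le
  have : DifferentiableOn ℂ (leftEval φ) (Metric.ball 0 r) := by
    refine Complex.differentiableOn_tsum_of_summable_norm (h r hr0 hr1) (fun n => ?_) Metric.isOpen_ball
      fun n w hw => ?_
    · fun_prop
    · rw [mem_ball_zero_iff] at hw
      rw [norm_mul, norm_pow, mul_comm]
      gcongr
  exact (this.differentiableAt (Metric.isOpen_ball.mem_nhds (by simpa using hzr))).differentiableWithinAt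

/-- The reciprocal of a real power series without zeros in the unit disc converges there. -/
theorem DiscSummable.inv {σ : ℝ⟦X⟧} (h : DiscSummable σ) (h0 : constantCoeff σ ≠ 0)
    (hne : ∀ z : ℂ, ‖z‖ < 1 → leftEval (PowerSeries.map (algebraMap ℝ ℂ) σ) z ≠ 0) :
    DiscSummable σ⁻¹ := by
  set s := PowerSeries.map (algebraMap ℝ ℂ) σ with hs
  have h2 : DiscSummable s := by
    intro r h0 h1
    simpa [hs] using h r h0 h1
  have hd : DifferentiableOn ℂ (fun z => (leftEval s z)⁻¹) (Metric.ball 0 1) :=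
    (leftEval_differentiableOn h2).inv fun z hz => hne z (by simpa using hz)
  -- The Taylor series of `1/s` converges on the whole disc because `s` has no zeros there;
  -- uniqueness of inverses identifies it with the formal series `σ⁻¹`.
  let τ : ℂ⟦X⟧ := PowerSeries.mk fun n =>
    ((n.factorial : ℂ))⁻¹ * iteratedDeriv n (fun z => (leftEval s z)⁻¹) 0
  have hτ : ∀ z : ℂ, ‖z‖ < 1 → HasSum (fun n => z ^ n * coeff n τ) (leftEval s z)⁻¹ := by
    intro z hz
    refine hasSum_of_eq (Complex.hasSum_taylorSeries_on_ball hd (z := z) (by simpa using hz))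
      fun n => ?_
    simp only [τ, coeff_mk, sub_zero, smul_eq_mul]
    ring
  have hτs : DiscSummable τ := by
    refine discSummable_of_summable fun r h0 h1 => ⟨(r : ℂ), by simpa using h0, ?_⟩
    exact (hτ r (by simpa [abs_of_nonneg h0] using h1)).summable
  have hmul : s * τ = 1 := by
    have : (fun n => coeff n (s * τ)) = fun n => coeff n (1 : ℂ⟦X⟧) := by
      refine coeff_unique (g := fun _ => 1) (fun t ht => ?_) (fun t ht => ?_)
      · have ht' : ‖(t : ℂ)‖ < 1 := by simpa using ht
        have := (h2.mul hτs).hasSum ht'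
        rw [leftEval_mul_of_commute h2 hτs ht' (Commute.all _ _), (hτs.hasSum ht').unique (hτ _ ht'),
          mul_inv_cancel₀ (hne _ ht')] at this
        refine hasSum_of_eq this fun n => ?_
        simp
      · refine hasSum_of_eq (hasSum_ite_eq (0 : ℕ) (1 : ℂ)) fun n => ?_
        by_cases hn : n = 0 <;> simp [hn, coeff_one]
    ext1 n
    exact congrFun this n
  have h3 : s * PowerSeries.map (algebraMap ℝ ℂ) σ⁻¹ = 1 := by
    rw [hs, ← map_mul, PowerSeries.mul_inv_cancel σ h0, map_one]
  have h4 : τ = PowerSeries.map (algebraMap ℝ ℂ) σ⁻¹ := by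
    calc τ = (s * PowerSeries.map (algebraMap ℝ ℂ) σ⁻¹) * τ := by rw [h3, one_mul]
      _ = (s * τ) * PowerSeries.map (algebraMap ℝ ℂ) σ⁻¹ := by ring
      _ = _ := by rw [hmul, one_mul]
  intro r h0 h1
  simpa [h4] using hτs r h0 h1

/-! ### The regular quotient -/

theorem norm_conj_lt_one {c q : ℍ[ℝ]} (hc : c ≠ 0) (hq : ‖q‖ < 1) : ‖c⁻¹ * q * c‖ < 1 := by
  have : ‖c‖ ≠ 0 := norm_ne_zero_iff.2 hc
  rw [norm_mul, norm_mul, norm_inv]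
  field_simp
  exact hq

theorem leftEval_conjSeries_ne_zero {k : ℍ[ℝ]⟦X⟧} (hk : DiscSummable k)
    (hne : ∀ q : ℍ[ℝ], ‖q‖ < 1 → leftEval k q ≠ 0) {q : ℍ[ℝ]} (hq : ‖q‖ < 1) :
    leftEval (conjSeries k) q ≠ 0 := by
  intro h0
  obtain ⟨p, hp, hp0⟩ := exists_zero_of_conjSeries hk hq h0
  exact hne p hp hp0

theorem leftEval_mul_conjSeries_ne_zero {k : ℍ[ℝ]⟦X⟧} (hk : DiscSummable k)
    (hne : ∀ q : ℍ[ℝ], ‖q‖ < 1 → leftEval k q ≠ 0) {q : ℍ[ℝ]} (hq : ‖q‖ < 1) :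
    leftEval (k * conjSeries k) q ≠ 0 := by
  rw [leftEval_mul_of_ne_zero hk hk.conjSeries hq (hne q hq)]
  exact mul_ne_zero (hne q hq) (leftEval_conjSeries_ne_zero hk hne (norm_conj_lt_one (hne q hq) hq))

theorem commute_mul_conjSeries (k φ : ℍ[ℝ]⟦X⟧) : Commute (k * conjSeries k) φ := by
  obtain ⟨σ, hσ⟩ := exists_real_mul_conjSeries k
  rw [hσ]
  exact commute_map_algebraMap σ φ

/-- Centrality of `k * conjSeries k` gives `k (k^c k) = (k k^c) k = k (k k^c)`, and `k` cancels. -/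
theorem conjSeries_mul_self (k : ℍ[ℝ]⟦X⟧) : conjSeries k * k = k * conjSeries k := by
  by_cases hk0 : k = 0
  · simp [hk0]
  · refine mul_left_cancel₀ hk0 ?_
    rw [← mul_assoc, (commute_mul_conjSeries k k).eq]

theorem commute_leftEval_mul_conjSeries {k : ℍ[ℝ]⟦X⟧} (hk : DiscSummable k) {q : ℍ[ℝ]}
    (hq : ‖q‖ < 1) : Commute q (leftEval (k * conjSeries k) q) := by
  obtain ⟨σ, hσ⟩ := exists_real_mul_conjSeries k
  have hσs : DiscSummable σ := by
    intro r h0 h1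
    have := (hk.mul hk.conjSeries) r h0 h1
    rw [hσ] at this
    simpa using this
  obtain ⟨I, hI, z, rfl, hz⟩ := exists_slicePoint q
  rw [hσ, leftEval_map_algebraMap hσs hI (by rwa [hz])]
  change _ * _ = _ * _
  rw [← slicePoint_mul hI, ← slicePoint_mul hI, mul_comm]

/-- If `k` has no zeros in the ball and `Re (k(q)⁻¹ g(q)) > 0` there, then the regular quotient
`k^{-*} * g` converges on the ball and has positive real part. -/
theorem exists_regular_quotient {k g : ℍ[ℝ]⟦X⟧} (hk : DiscSummable k) (hg : DiscSummable g)
    (hne : ∀ q : ℍ[ℝ], ‖q‖ < 1 → leftEval k q ≠ 0)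
    (hpos : ∀ q : ℍ[ℝ], ‖q‖ < 1 → 0 < ((leftEval k q)⁻¹ * leftEval g q).re) :
    ∃ p : ℍ[ℝ]⟦X⟧, DiscSummable p ∧ g = k * p ∧
      ∀ q : ℍ[ℝ], ‖q‖ < 1 → 0 < (leftEval p q).re := by
  have hkc := hk.conjSeries
  have hnec : ∀ q : ℍ[ℝ], ‖q‖ < 1 → leftEval (conjSeries k) q ≠ 0 := fun q hq =>
    leftEval_conjSeries_ne_zero hk hne hq
  obtain ⟨σ, hσ⟩ := exists_real_mul_conjSeries k
  have hσs : DiscSummable σ := by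
    intro r h0 h1
    have := (hk.mul hkc) r h0 h1
    rw [hσ] at this
    simpa using this
  have hs0 : ∀ q : ℍ[ℝ], ‖q‖ < 1 → leftEval (k * conjSeries k) q ≠ 0 := fun q hq =>
    leftEval_mul_conjSeries_ne_zero hk hne hq
  have hσ0 : constantCoeff σ ≠ 0 := by
    intro h0
    refine hs0 0 (by simp) ?_
    rw [leftEval_zero, hσ, coeff_map, coeff_zero_eq_constantCoeff_apply, h0, map_zero]
  have hτ : DiscSummable σ⁻¹ := by
    refine hσs.inv hσ0 fun z hz h0 => ?_
    have hI := basisI_mem_imagUnits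
    have := leftEval_map_algebraMap hσs hI hz
    rw [h0, ← hσ] at this
    refine hs0 _ (by rwa [norm_slicePoint hI]) (this.trans ?_)
    simp [slicePoint]
  set T : ℍ[ℝ]⟦X⟧ := PowerSeries.map (algebraMap ℝ ℍ[ℝ]) σ⁻¹ with hT
  have hTs : DiscSummable T := by
    intro r h0 h1
    simpa [hT] using hτ r h0 h1
  have hkT : k * conjSeries k * T = 1 := by
    rw [hσ, hT, ← map_mul, PowerSeries.mul_inv_cancel σ hσ0, map_one]
  have hcomm : Commute T k := commute_map_algebraMap _ _
  have hg' : g = k * (T * conjSeries k * g) := by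
    calc g = k * conjSeries k * T * g := by rw [hkT, one_mul]
      _ = T * (k * conjSeries k) * g := by
        rw [(commute_map_algebraMap σ⁻¹ (k * conjSeries k)).eq]
      _ = T * k * (conjSeries k * g) := by simp only [mul_assoc]
      _ = _ := by rw [hcomm.eq]; simp only [mul_assoc]
  have hps : DiscSummable (T * conjSeries k * g) := (hTs.mul hkc).mul hg
  refine ⟨_, hps, hg', fun q hq => ?_⟩
  set c := leftEval (conjSeries k) q with hc
  have hc0 : c ≠ 0 := hnec q hq
  -- This is the preimage of `q` under `x ↦ k(x)⁻¹ x k(x)`: the number `c k(q')` is the value at `q`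
  -- of the symmetrization, hence commutes with `q`.
  set q' := c⁻¹ * q * c with hq'
  have hq'1 : ‖q'‖ < 1 := norm_conj_lt_one hc0 hq
  have h1 : Commute q (c * leftEval k q') := by
    have h2 := leftEval_mul_of_ne_zero hkc hk hq hc0
    rw [← hc, ← hq'] at h2
    rw [← h2, conjSeries_mul_self]
    exact commute_leftEval_mul_conjSeries hk hq
  have h2 : (leftEval k q')⁻¹ * q' * leftEval k q' = q := by
    have h3 : q' * leftEval k q' = leftEval k q' * q := by
      rw [hq', mul_assoc, mul_assoc, h1.eq, mul_assoc, inv_mul_cancel_left₀ hc0]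
    rw [mul_assoc, h3, inv_mul_cancel_left₀ (hne q' hq'1)]
  have h4 := hpos q' hq'1
  have h5 := leftEval_mul_of_ne_zero hk hps hq'1 (hne q' hq'1)
  rw [← hg', h2] at h5
  rwa [h5, inv_mul_cancel_left₀ (hne q' hq'1)] at h4

/-! ### Carathéodory's theorem in the disc, through Fourier coefficients -/

section Caratheodory

open Complex Real intervalIntegral MeasureTheory
open scoped ComplexConjugate

theorem integral_exp_int_mul_I (m : ℤ) :
    ∫ θ in (0 : ℝ)..2 * π, Complex.exp (m * θ * Complex.I) = if m = 0 then 2 * π else 0 := by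
  split_ifs with h
  · simp [h]
  · have hc : (m : ℂ) * Complex.I ≠ 0 := by simp [h]
    have : ∀ θ : ℝ, Complex.exp (m * θ * Complex.I) = Complex.exp ((m * Complex.I) * θ) := by
      intro θ; ring_nf
    simp_rw [this]
    rw [integral_exp_mul_complex hc]
    have h2 : Complex.exp (m * Complex.I * ((2 * π : ℝ) : ℂ)) = 1 := by
      rw [← Complex.exp_int_mul_two_pi_mul_I m]
      congr 1
      push_cast
      ring
    rw [h2]
    simp

/-- Fourier coefficients of an absolutely convergent series of exponentials. -/
theorem integral_tsum_exp {a : ℕ → ℂ} (ha : Summable fun n => ‖a n‖) (m : ℤ) :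
    ∫ θ in (0 : ℝ)..2 * π, (∑' n : ℕ, Complex.exp (n * θ * Complex.I) * a n) *
      Complex.exp (m * θ * Complex.I) =
      ∑' n : ℕ, if (n : ℤ) + m = 0 then 2 * π * a n else 0 := by
  have h := intervalIntegral.hasSum_integral_of_dominated_convergence (μ := volume)
    (a := 0) (b := 2 * π) (ι := ℕ)
    (F := fun n θ => Complex.exp (n * θ * Complex.I) * a n * Complex.exp (m * θ * Complex.I))
    (f := fun θ => (∑' n : ℕ, Complex.exp (n * θ * Complex.I) * a n) *
      Complex.exp (m * θ * Complex.I))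
    (fun n _ => ‖a n‖) (fun n => by
      refine Continuous.aestronglyMeasurable ?_
      fun_prop) (fun n => Filter.Eventually.of_forall fun θ _ => by
      have e1 : ‖Complex.exp (n * θ * Complex.I)‖ = 1 := by
        have := Complex.norm_exp_ofReal_mul_I (n * θ)
        push_cast at this
        exact this
      have e2 : ‖Complex.exp (m * θ * Complex.I)‖ = 1 := by
        have := Complex.norm_exp_ofReal_mul_I (m * θ)
        push_cast at this
        exact this
      rw [norm_mul, norm_mul, e1, e2]
      simp) (Filter.Eventually.of_forall fun θ _ => ha) (by simp)
    (Filter.Eventually.of_forall fun θ _ => by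
      refine HasSum.mul_right _ ?_
      refine (Summable.of_norm_bounded ha fun n => ?_).hasSum
      have e1 : ‖Complex.exp (n * θ * Complex.I)‖ = 1 := by
        have := Complex.norm_exp_ofReal_mul_I (n * θ)
        push_cast at this
        exact this
      rw [norm_mul, e1, one_mul])
  rw [← h.tsum_eq]
  refine tsum_congr fun n => ?_
  have e : ∀ θ : ℝ, Complex.exp (n * θ * Complex.I) * a n * Complex.exp (m * θ * Complex.I) =
      Complex.exp (((n + m : ℤ) : ℂ) * θ * Complex.I) * a n := by
    intro θ
    rw [mul_right_comm, ← Complex.exp_add]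
    push_cast
    ring_nf
  simp_rw [e]
  rw [intervalIntegral.integral_mul_const, integral_exp_int_mul_I]
  split_ifs <;> simp

theorem continuous_tsum_exp {a : ℕ → ℂ} (ha : Summable fun n => ‖a n‖) :
    Continuous fun θ : ℝ => ∑' n : ℕ, Complex.exp (n * θ * Complex.I) * a n := by
  refine continuous_tsum (fun n => by fun_prop) ha fun n θ => ?_
  have e1 : ‖Complex.exp (n * θ * Complex.I)‖ = 1 := by
    have := Complex.norm_exp_ofReal_mul_I (n * θ)
    push_cast at this
    exact this
  rw [norm_mul, e1, one_mul]

/-- The Fourier coefficients of the real part of a power series. -/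
theorem integral_re_tsum_exp {a : ℕ → ℂ} (ha : Summable fun n => ‖a n‖) (h0 : a 0 = 1) (n : ℕ) :
    ∫ θ in (0 : ℝ)..2 * π, ((∑' n : ℕ, Complex.exp (n * θ * Complex.I) * a n).re : ℂ) *
      Complex.exp (-(n * θ * Complex.I)) = π * (if n = 0 then 2 else a n) := by
  set S : ℝ → ℂ := fun θ => ∑' n : ℕ, Complex.exp (n * θ * Complex.I) * a n with hS
  have hSc : Continuous S := continuous_tsum_exp ha
  have i1 : ∫ θ in (0 : ℝ)..2 * π, S θ * Complex.exp (((-n : ℤ) : ℂ) * θ * Complex.I) =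
      2 * π * a n := by
    rw [hS, integral_tsum_exp ha, tsum_eq_single n]
    · simp
    · intro k hk
      rw [if_neg]
      omega
  -- The conjugate part of `2 Re S` has no positive frequencies, so it contributes only at `n = 0`;
  -- this is why the zeroth coefficient becomes 2.
  have i2 : ∫ θ in (0 : ℝ)..2 * π, conj (S θ * Complex.exp (((n : ℤ) : ℂ) * θ * Complex.I)) =
      if n = 0 then 2 * π else 0 := by
    have := Complex.conjCLE.toContinuousLinearMap.intervalIntegral_comp_comm (μ := volume)
      (a := 0) (b := 2 * π)
      (f := fun θ => S θ * Complex.exp (((n : ℤ) : ℂ) * θ * Complex.I))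
      (Continuous.intervalIntegrable (by fun_prop) _ _)
    refine Eq.trans this ?_
    change conj (∫ θ in (0 : ℝ)..2 * π, S θ * Complex.exp (((n : ℤ) : ℂ) * θ * Complex.I)) = _
    rw [hS, integral_tsum_exp ha, tsum_eq_single 0]
    · by_cases hn : n = 0
      · simp [hn, h0, map_ofNat (starRingEnd ℂ) 2]
      · simp [hn]
    · intro k hk
      rw [if_neg]
      omega
  have e : ∀ θ : ℝ, ((S θ).re : ℂ) * Complex.exp (-(n * θ * Complex.I)) =
      (1 / 2 : ℂ) * (S θ * Complex.exp (((-n : ℤ) : ℂ) * θ * Complex.I) +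
        conj (S θ * Complex.exp (((n : ℤ) : ℂ) * θ * Complex.I))) := by
    intro θ
    rw [map_mul, ← Complex.exp_conj]
    simp only [map_mul, Complex.conj_ofReal, Complex.conj_I, map_intCast]
    rw [Complex.re_eq_add_conj]
    push_cast
    simp only [mul_neg, neg_mul]
    ring
  change ∫ θ in (0 : ℝ)..2 * π, ((S θ).re : ℂ) * Complex.exp (-(n * θ * Complex.I)) = _
  simp_rw [e]
  rw [intervalIntegral.integral_const_mul, intervalIntegral.integral_add, i1, i2]
  · by_cases hn : n = 0
    · simp [hn, h0]; ring
    · simp [hn]; ring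
  · exact Continuous.intervalIntegrable (by fun_prop) _ _
  · exact Continuous.intervalIntegrable (by fun_prop) _ _

theorem norm_integral_mul_exp_le {P : ℝ → ℝ} (hP : ∀ θ, 0 ≤ P θ) (n : ℕ) :
    ‖∫ θ in (0 : ℝ)..2 * π, (P θ : ℂ) * Complex.exp (-(n * θ * Complex.I))‖ ≤
      ∫ θ in (0 : ℝ)..2 * π, P θ := by
  refine (intervalIntegral.norm_integral_le_integral_norm (by positivity)).trans (le_of_eq ?_)
  congr 1
  funext θ
  have e1 : ‖Complex.exp (-(n * θ * Complex.I))‖ = 1 := by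
    have := Complex.norm_exp_ofReal_mul_I (-(n * θ))
    push_cast at this
    rwa [neg_mul] at this
  rw [norm_mul, e1, mul_one, Complex.norm_real, Real.norm_of_nonneg (hP θ)]

/-- A second difference bound for the Fourier coefficients of a nonnegative function. -/
theorem norm_second_difference_le {P : ℝ → ℝ} (hc : Continuous P) (hP : ∀ θ, 0 ≤ P θ) {M : ℕ → ℂ}
    (hM : ∀ n : ℕ, ∫ θ in (0 : ℝ)..2 * π, (P θ : ℂ) * Complex.exp (-(n * θ * Complex.I)) = M n)
    {u : ℂ} (hu : ‖u‖ = 1) (n : ℕ) :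
    ‖M (n + 1) - (1 / 2 : ℂ) * (u * M n + conj u * M (n + 2))‖ ≤ (M 0).re - (conj u * M 1).re := by
  -- This nonnegative weight has frequencies `-1, 0, 1`, so multiplying `P` by it turns a Fourier
  -- coefficient into a second difference; it is small in mean when `P` concentrates where the first
  -- coefficient is extremal.
  set w : ℝ → ℝ := fun θ => 1 - (conj u * Complex.exp (-(θ * Complex.I))).re with hw
  have hwc : Continuous w := by fun_prop
  have hw0 : ∀ θ, 0 ≤ w θ := by
    intro θ
    have e1 : ‖Complex.exp (-(θ * Complex.I))‖ = 1 := by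
      have := Complex.norm_exp_ofReal_mul_I (-θ)
      push_cast at this
      rwa [neg_mul] at this
    have := Complex.re_le_norm (conj u * Complex.exp (-(θ * Complex.I)))
    rw [norm_mul, e1, Complex.norm_conj, hu] at this
    simp only [hw]
    linarith
  have hMi : ∀ n : ℕ, IntervalIntegrable
      (fun θ : ℝ => (P θ : ℂ) * Complex.exp (-(n * θ * Complex.I))) volume 0 (2 * π) := fun n =>
    Continuous.intervalIntegrable (by fun_prop) _ _
  have key := norm_integral_mul_exp_le (P := fun θ => P θ * w θ) (fun θ => mul_nonneg (hP θ) (hw0 θ)) (n + 1)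
  have h1 : ∫ θ in (0 : ℝ)..2 * π, ((P θ * w θ : ℝ) : ℂ) *
      Complex.exp (-((n + 1 : ℕ) * θ * Complex.I)) =
      M (n + 1) - (1 / 2 : ℂ) * (u * M n + conj u * M (n + 2)) := by
    have e : ∀ θ : ℝ, ((P θ * w θ : ℝ) : ℂ) * Complex.exp (-((n + 1 : ℕ) * θ * Complex.I)) =
        (P θ : ℂ) * Complex.exp (-((n + 1 : ℕ) * θ * Complex.I)) - (1 / 2 : ℂ) *
          (u * ((P θ : ℂ) * Complex.exp (-((n : ℕ) * θ * Complex.I))) +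
          conj u * ((P θ : ℂ) * Complex.exp (-((n + 2 : ℕ) * θ * Complex.I)))) := by
      intro θ
      have e1 : Complex.exp (-((n + 2 : ℕ) * θ * Complex.I)) =
          Complex.exp (-(θ * Complex.I)) * Complex.exp (-((n + 1 : ℕ) * θ * Complex.I)) := by
        rw [← Complex.exp_add]; push_cast; ring_nf
      have e2 : Complex.exp (-((n : ℕ) * θ * Complex.I)) =
          Complex.exp (θ * Complex.I) * Complex.exp (-((n + 1 : ℕ) * θ * Complex.I)) := by
        rw [← Complex.exp_add]; push_cast; ring_nf
      have e3 : ((w θ : ℝ) : ℂ) = 1 - (1 / 2 : ℂ) *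
          (conj u * Complex.exp (-(θ * Complex.I)) + u * Complex.exp (θ * Complex.I)) := by
        simp only [hw]
        rw [Complex.ofReal_sub, Complex.re_eq_add_conj, map_mul, ← Complex.exp_conj]
        simp
        ring
      rw [e1, e2, Complex.ofReal_mul, e3]
      ring
    simp_rw [e]
    rw [intervalIntegral.integral_sub, intervalIntegral.integral_const_mul,
      intervalIntegral.integral_add, intervalIntegral.integral_const_mul,
      intervalIntegral.integral_const_mul, hM, hM, hM]
    · exact (hMi _).const_mul _
    · exact (hMi _).const_mul _
    · exact hMi _
    · exact (((hMi _).const_mul _).add ((hMi _).const_mul _)).const_mul _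
  have h2 : ∫ θ in (0 : ℝ)..2 * π, P θ * w θ = (M 0).re - (conj u * M 1).re := by
    have e : ∀ θ : ℝ, P θ * w θ = Complex.reCLM ((P θ : ℂ) * Complex.exp (-((0 : ℕ) * θ * Complex.I)) -
        conj u * ((P θ : ℂ) * Complex.exp (-((1 : ℕ) * θ * Complex.I)))) := by
      intro θ
      have : conj u * ((P θ : ℂ) * Complex.exp (-((1 : ℕ) * θ * Complex.I))) =
          (P θ : ℂ) * (conj u * Complex.exp (-(θ * Complex.I))) := by
        push_cast
        ring_nf
      rw [this]
      simp only [Complex.reCLM_apply, Complex.sub_re, Complex.re_ofReal_mul, hw]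
      simp
      ring
    simp_rw [e]
    rw [ContinuousLinearMap.intervalIntegral_comp_comm _ ((hMi 0).sub ((hMi 1).const_mul _)),
      intervalIntegral.integral_sub (hMi 0) ((hMi 1).const_mul _),
      intervalIntegral.integral_const_mul, hM, hM]
    simp
  rw [h1, h2] at key
  exact key

/-- `P` is the real part of the series on the circle of radius `r`; staying inside the disc ensures
absolute convergence. -/
theorem caratheodory_fourier {a : ℕ → ℂ} (ha : ∀ r : ℝ, 0 ≤ r → r < 1 → Summable fun n => ‖a n‖ * r ^ n)
    (h0 : a 0 = 1) (hpos : ∀ z : ℂ, ‖z‖ < 1 → 0 ≤ (∑' n : ℕ, z ^ n * a n).re) {r : ℝ} (hr0 : 0 ≤ r)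
    (hr1 : r < 1) : ∃ P : ℝ → ℝ, Continuous P ∧ (∀ θ, 0 ≤ P θ) ∧ ∀ n : ℕ,
      ∫ θ in (0 : ℝ)..2 * π, (P θ : ℂ) * Complex.exp (-(n * θ * Complex.I)) =
        π * (if n = 0 then 2 else a n * r ^ n) := by
  have hs : Summable fun n => ‖a n * (r : ℂ) ^ n‖ := by
    refine (ha r hr0 hr1).congr fun n => ?_
    rw [norm_mul, norm_pow, Complex.norm_real, Real.norm_of_nonneg hr0]
  refine ⟨fun θ => (∑' n : ℕ, Complex.exp (n * θ * Complex.I) * (a n * (r : ℂ) ^ n)).re,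
    Complex.continuous_re.comp (continuous_tsum_exp hs), fun θ => ?_,
    integral_re_tsum_exp hs (by simp [h0])⟩
  have hz : ‖(r : ℂ) * Complex.exp (θ * Complex.I)‖ < 1 := by
    rw [norm_mul, Complex.norm_exp_ofReal_mul_I, mul_one, Complex.norm_real,
      Real.norm_of_nonneg hr0]
    exact hr1
  have := hpos _ hz
  have e : ∀ n : ℕ, ((r : ℂ) * Complex.exp (θ * Complex.I)) ^ n * a n =
      Complex.exp (n * θ * Complex.I) * (a n * (r : ℂ) ^ n) := by
    intro n
    rw [mul_pow, ← Complex.exp_nat_mul, mul_assoc (n : ℂ)]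
    ring
  simpa only [e] using this

/-- Carathéodory's coefficient bound for functions with positive real part. -/
theorem caratheodory_norm_le {a : ℕ → ℂ} (ha : ∀ r : ℝ, 0 ≤ r → r < 1 → Summable fun n => ‖a n‖ * r ^ n)
    (h0 : a 0 = 1) (hpos : ∀ z : ℂ, ‖z‖ < 1 → 0 ≤ (∑' n : ℕ, z ^ n * a n).re) {n : ℕ} (hn : n ≠ 0) :
    ‖a n‖ ≤ 2 := by
  have key : ∀ r ∈ Set.Ioo (0 : ℝ) 1, ‖a n * (r : ℂ) ^ n‖ ≤ 2 := by
    rintro r ⟨hr0, hr1⟩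
    obtain ⟨P, hc, hP, hM⟩ := caratheodory_fourier ha h0 hpos hr0.le hr1
    have h1 := norm_integral_mul_exp_le hP n
    have h2 : ((∫ θ in (0 : ℝ)..2 * π, P θ : ℝ) : ℂ) = π * 2 := by
      have := hM 0
      rw [← intervalIntegral.integral_ofReal]
      simpa using this
    have h3 : ∫ θ in (0 : ℝ)..2 * π, P θ = π * 2 := by exact_mod_cast h2
    rw [hM, h3, if_neg hn, norm_mul, Complex.norm_real, Real.norm_of_nonneg pi_pos.le] at h1
    exact le_of_mul_le_mul_left h1 pi_pos
  have hlim : Filter.Tendsto (fun r : ℝ => ‖a n * (r : ℂ) ^ n‖) (nhdsWithin 1 (Set.Iio 1))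
      (nhds ‖a n * ((1 : ℝ) : ℂ) ^ n‖) := by
    refine Filter.Tendsto.mono_left (Continuous.tendsto (by fun_prop) _) nhdsWithin_le_nhds
  have := le_of_tendsto hlim (Filter.eventually_of_mem (Ioo_mem_nhdsLT one_pos) key)
  simpa using this

/-- The equality case of Carathéodory's bound for the first coefficient. -/
theorem caratheodory_eq {a : ℕ → ℂ} (ha : ∀ r : ℝ, 0 ≤ r → r < 1 → Summable fun n => ‖a n‖ * r ^ n)
    (h0 : a 0 = 1) (hpos : ∀ z : ℂ, ‖z‖ < 1 → 0 ≤ (∑' n : ℕ, z ^ n * a n).re) {u : ℂ}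
    (hu : ‖u‖ = 1) (h1 : a 1 = 2 * u) (n : ℕ) : a (n + 1) = 2 * u ^ (n + 1) := by
  set b : ℝ → ℕ → ℂ := fun r n => if n = 0 then 2 else a n * (r : ℂ) ^ n with hb
  have huu : u * conj u = 1 := by
    rw [Complex.mul_conj, Complex.normSq_eq_norm_sq, hu]; simp
  -- At radius `r` the recursion holds up to an error `2 - 2r`, which vanishes as `r → 1`.
  have key : ∀ n, b 1 (n + 1) = (1 / 2 : ℂ) * (u * b 1 n + conj u * b 1 (n + 2)) := by
    intro n
    have hle : ∀ r ∈ Set.Ioo (0 : ℝ) 1,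
        ‖b r (n + 1) - (1 / 2 : ℂ) * (u * b r n + conj u * b r (n + 2))‖ ≤ 2 - 2 * r := by
      rintro r ⟨hr0, hr1⟩
      obtain ⟨P, hc, hP, hM⟩ := caratheodory_fourier ha h0 hpos hr0.le hr1
      have h := norm_second_difference_le hc hP (M := fun n => π * b r n) hM hu n
      have e1 : (π : ℂ) * b r (n + 1) - (1 / 2 : ℂ) *
          (u * (π * b r n) + conj u * (π * b r (n + 2))) =
          π * (b r (n + 1) - (1 / 2 : ℂ) * (u * b r n + conj u * b r (n + 2))) := by ring
      have e2 : ((π : ℂ) * b r 0).re - (conj u * (π * b r 1)).re = π * (2 - 2 * r) := by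
        have : conj u * (π * b r 1) = ((2 * π * r : ℝ) : ℂ) := by
          simp only [hb, one_ne_zero, if_false, h1, pow_one]
          push_cast
          linear_combination (2 * π * r : ℂ) * huu
        rw [this, Complex.ofReal_re]
        simp [hb]
        ring
      rw [e1, e2, norm_mul, Complex.norm_real, Real.norm_of_nonneg pi_pos.le] at h
      exact le_of_mul_le_mul_left h pi_pos
    have hbc : ∀ n, Continuous fun r => b r n := by
      intro n
      simp only [hb]
      split_ifs <;> fun_prop
    have hl : Continuous fun r =>
        ‖b r (n + 1) - (1 / 2 : ℂ) * (u * b r n + conj u * b r (n + 2))‖ := by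
      have := hbc n
      have := hbc (n + 1)
      have := hbc (n + 2)
      fun_prop
    have hlim := (hl.tendsto 1).mono_left (nhdsWithin_le_nhds (s := Set.Iio 1))
    have hr : Continuous fun r : ℝ => 2 - 2 * r := by fun_prop
    have hlim2 := (hr.tendsto 1).mono_left (nhdsWithin_le_nhds (s := Set.Iio 1))
    have := le_of_tendsto_of_tendsto hlim hlim2
      (Filter.eventually_of_mem (Ioo_mem_nhdsLT one_pos) hle)
    rw [mul_one, sub_self] at this
    exact sub_eq_zero.1 (norm_le_zero_iff.1 this)
  have hmain : ∀ n, b 1 n = 2 * u ^ n ∧ b 1 (n + 1) = 2 * u ^ (n + 1) := by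
    intro n
    induction n with
    | zero => simp [hb, h1]
    | succ n ih =>
      refine ⟨ih.2, ?_⟩
      have h := key n
      rw [ih.1, ih.2] at h
      have h' : u * (2 * u ^ (n + 1)) = u * ((1 / 2 : ℂ) * (u * (2 * u ^ n) + conj u * b 1 (n + 2))) := by
        rw [h]
      rw [show n + 1 + 1 = n + 2 from rfl]
      linear_combination -2 * h' - b 1 (n + 2) * huu
  have := (hmain n).2
  simpa [hb] using this

end Caratheodory

/-! ### Carathéodory's theorem for quaternionic power series -/

/-- The component in `ℂ_I ≅ ℂ` of a quaternion. -/
def sliceProj (I p : ℍ[ℝ]) : ℂ := ⟨p.re, -(I * p).re⟩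

/-- The orthogonal complement of `ℂ_I` is stable under multiplication by `ℂ_I` and has zero real
part. Hence a condition on the real part of a regular function on `ℂ_I` concerns only the projected
coefficients. -/
theorem re_slicePoint_mul (I : ℍ[ℝ]) (z : ℂ) (p : ℍ[ℝ]) :
    (slicePoint I z * p).re = (z * sliceProj I p).re := by
  simp only [slicePoint, add_mul, Quaternion.coe_mul_eq_smul, smul_mul_assoc, sliceProj,
    Complex.mul_re]
  simp only [Quaternion.re_add, Quaternion.re_smul, smul_eq_mul]
  ring

theorem sliceProj_slicePoint {I : ℍ[ℝ]} (hI : I ∈ imagUnits) (z : ℂ) :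
    sliceProj I (slicePoint I z) = z := by
  have h0 := (re_norm_of_mem_imagUnits hI).1
  apply Complex.ext
  · simp [sliceProj, slicePoint, h0]
  · change -(I * slicePoint I z).re = z.im
    have h1 : I * slicePoint I z = slicePoint I (Complex.I * z) := by
      rw [slicePoint_mul hI, slicePoint_I]
    rw [h1]
    simp [slicePoint, h0]

theorem re_mul_comm (a b : ℍ[ℝ]) : (a * b).re = (b * a).re := by
  simp only [Quaternion.re_mul]
  ring

/-- Pythagoras: `sliceProj I` is the orthogonal projection onto `ℂ_I`. -/
theorem norm_sub_slicePoint_sq {I : ℍ[ℝ]} (hI : I ∈ imagUnits) (p : ℍ[ℝ]) :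
    ‖p - slicePoint I (sliceProj I p)‖ ^ 2 = ‖p‖ ^ 2 - ‖sliceProj I p‖ ^ 2 := by
  have h := norm_sub_sq_real p (slicePoint I (sliceProj I p))
  have h2 : inner ℝ p (slicePoint I (sliceProj I p)) = ‖sliceProj I p‖ ^ 2 := by
    rw [Quaternion.inner_def, star_slicePoint hI, re_mul_comm, re_slicePoint_mul,
      ← Complex.normSq_eq_norm_sq, mul_comm]
    change (sliceProj I p * (starRingEnd ℂ) (sliceProj I p)).re = _
    rw [Complex.mul_conj, Complex.ofReal_re]
  rw [h, h2, norm_slicePoint hI]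
  ring

theorem norm_sliceProj_le {I : ℍ[ℝ]} (hI : I ∈ imagUnits) (p : ℍ[ℝ]) : ‖sliceProj I p‖ ≤ ‖p‖ := by
  have h := norm_sub_slicePoint_sq hI p
  have := sq_nonneg ‖p - slicePoint I (sliceProj I p)‖
  exact le_of_sq_le_sq (by linarith) (norm_nonneg _)

theorem exists_slice_sliceProj (p : ℍ[ℝ]) : ∃ I ∈ imagUnits, slicePoint I (sliceProj I p) = p := by
  obtain ⟨I, hI, z, rfl, -⟩ := exists_slicePoint p
  exact ⟨I, hI, by rw [sliceProj_slicePoint hI]⟩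

section

variable {p : ℍ[ℝ]⟦X⟧} (hp : DiscSummable p) (h0 : coeff 0 p = 1)
  (hpos : ∀ q : ℍ[ℝ], ‖q‖ < 1 → 0 < (leftEval p q).re)

include hp in
theorem DiscSummable.sliceProj {I : ℍ[ℝ]} (hI : I ∈ imagUnits) (r : ℝ) (hr0 : 0 ≤ r) (hr1 : r < 1) :
    Summable fun n => ‖sliceProj I (coeff n p)‖ * r ^ n := by
  refine Summable.of_nonneg_of_le (fun n => by positivity) (fun n => ?_) (hp r hr0 hr1)
  gcongr
  exact norm_sliceProj_le hI _

include hp hpos in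
theorem re_tsum_sliceProj_nonneg {I : ℍ[ℝ]} (hI : I ∈ imagUnits) (z : ℂ) (hz : ‖z‖ < 1) :
    0 ≤ (∑' n : ℕ, z ^ n * sliceProj I (coeff n p)).re := by
  have hq : ‖slicePoint I z‖ < 1 := by rwa [norm_slicePoint hI]
  have h1 : HasSum (fun n => (slicePoint I z ^ n * coeff n p).re) (leftEval p (slicePoint I z)).re :=
    (hp.hasSum hq).map (AddMonoidHom.mk' (fun q : ℍ[ℝ] => q.re) (by simp)) Quaternion.continuous_re
  have h2 : Summable fun n : ℕ => z ^ n * sliceProj I (coeff n p) := by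
    refine Summable.of_norm_bounded (hp.sliceProj hI ‖z‖ (norm_nonneg z) hz) fun n => ?_
    rw [norm_mul, norm_pow, mul_comm]
  have h3 : HasSum (fun n => (z ^ n * sliceProj I (coeff n p)).re)
      (∑' n : ℕ, z ^ n * sliceProj I (coeff n p)).re := Complex.hasSum_re h2.hasSum
  have h4 := h3.unique (hasSum_of_eq h1 fun n => by
    rw [← re_slicePoint_mul, slicePoint_pow hI])
  rw [h4]
  exact (hpos _ hq).le

include hp h0 hpos in
/-- Carathéodory's bound for regular functions with positive real part. -/
theorem norm_coeff_le_two {n : ℕ} (hn : n ≠ 0) : ‖coeff n p‖ ≤ 2 := by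
  -- In a plane that contains the coefficient, the projection loses nothing of its norm.
  obtain ⟨I, hI, h⟩ := exists_slice_sliceProj (coeff n p)
  rw [← h, norm_slicePoint hI]
  refine caratheodory_norm_le (a := fun n => SliceReg.sliceProj I (coeff n p)) (hp.sliceProj hI) ?_
    (re_tsum_sliceProj_nonneg hp hpos hI) hn
  rw [h0]
  apply Complex.ext <;> simp [SliceReg.sliceProj, (re_norm_of_mem_imagUnits hI).1]

include hp h0 hpos in
-- In the plane of the first coefficient the complex equality case gives projections `2uⁿ`. These
-- already have norm 2, so the bound leaves no room for an orthogonal component.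
theorem coeff_eq_of_norm_coeff_one (h1 : ‖coeff 1 p‖ = 2) :
    ∃ u : ℍ[ℝ], ‖u‖ = 1 ∧ ∀ n : ℕ, n ≠ 0 → coeff n p = 2 * u ^ n := by
  obtain ⟨I, hI, h⟩ := exists_slice_sliceProj (coeff 1 p)
  set v := SliceReg.sliceProj I (coeff 1 p) with hv
  have hv2 : ‖v‖ = 2 := by rw [← norm_slicePoint hI, h, h1]
  have hu : ‖v / 2‖ = 1 := by rw [norm_div, hv2]; simp
  refine ⟨slicePoint I (v / 2), by rw [norm_slicePoint hI, hu], fun n hn => ?_⟩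
  have h2 := caratheodory_eq (a := fun n => SliceReg.sliceProj I (coeff n p)) (hp.sliceProj hI)
    (by
      rw [h0]
      apply Complex.ext <;> simp [SliceReg.sliceProj, (re_norm_of_mem_imagUnits hI).1])
    (re_tsum_sliceProj_nonneg hp hpos hI) hu (by
      change v = _
      ring) (n - 1)
  rw [Nat.sub_add_cancel (Nat.one_le_iff_ne_zero.2 hn)] at h2
  have h3 := norm_sub_slicePoint_sq hI (coeff n p)
  have h4 := norm_coeff_le_two hp h0 hpos hn
  have h5 : ‖SliceReg.sliceProj I (coeff n p)‖ = 2 := by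
    rw [h2, norm_mul, norm_pow, hu]; simp
  have h6 : ‖coeff n p - slicePoint I (SliceReg.sliceProj I (coeff n p))‖ = 0 := by
    have : ‖coeff n p - slicePoint I (SliceReg.sliceProj I (coeff n p))‖ ^ 2 ≤ 0 := by
      rw [h3, h5]
      nlinarith [norm_nonneg (coeff n p)]
    exact pow_eq_zero_iff two_ne_zero |>.1 (le_antisymm this (sq_nonneg _))
  rw [sub_eq_zero.1 (norm_eq_zero.1 h6), h2, slicePoint_mul hI, slicePoint_pow hI]
  congr 1
  exact slicePoint_ofReal I 2

end

/-! ### The slice derivative of a power series -/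

/-- Termwise derivative of a power series. -/
def derivSeries (φ : ℍ[ℝ]⟦X⟧) : ℍ[ℝ]⟦X⟧ :=
  PowerSeries.mk fun n => ((n : ℝ) + 1) • coeff (n + 1) φ

@[simp] theorem coeff_derivSeries (φ : ℍ[ℝ]⟦X⟧) (n : ℕ) :
    coeff n (derivSeries φ) = ((n : ℝ) + 1) • coeff (n + 1) φ := by
  simp [derivSeries]

theorem discSummable_shift {φ ψ : ℍ[ℝ]⟦X⟧} (hφ : DiscSummable φ)
    (h : ∀ n, coeff n ψ = coeff (n + 1) φ) : DiscSummable ψ := by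
  intro r h0 h1
  obtain ⟨s, hrs, hs1⟩ := exists_between h1
  have hs0 : 0 < s := h0.trans_lt hrs
  have := ((summable_nat_add_iff 1).2 (hφ s hs0.le hs1)).mul_left s⁻¹
  refine Summable.of_nonneg_of_le (fun n => by positivity) (fun n => ?_) this
  rw [h, pow_succ]
  calc ‖coeff (n + 1) φ‖ * r ^ n ≤ ‖coeff (n + 1) φ‖ * s ^ n := by gcongr
    _ = _ := by field_simp

theorem DiscSummable.derivSeries {φ : ℍ[ℝ]⟦X⟧} (hφ : DiscSummable φ) :
    DiscSummable (derivSeries φ) := by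
  have h : DiscSummable (PowerSeries.mk fun n : ℕ => (n : ℝ) • coeff n φ) := by
    refine discSummable_of_norm_le (a := fun n => ‖coeff n φ‖) 1 hφ (fun _ => norm_nonneg _)
      fun n => ?_
    rw [coeff_mk, norm_smul, pow_one, Real.norm_of_nonneg (Nat.cast_nonneg n)]
  exact discSummable_shift h fun n => by simp

/-- `slicePoint I` as a continuous linear map. -/
def slicePointL (I : ℍ[ℝ]) : ℂ →L[ℝ] ℍ[ℝ] :=
  LinearMap.toContinuousLinearMap
    { toFun := slicePoint I
      map_add' := slicePoint_add I
      map_smul' := fun t z => by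
        simp only [slicePoint, Complex.real_smul, Complex.re_ofReal_mul, Complex.im_ofReal_mul,
          Quaternion.coe_mul, smul_add, RingHom.id_apply, ← Quaternion.coe_mul_eq_smul, mul_assoc] }

@[simp] theorem slicePointL_apply (I : ℍ[ℝ]) (z : ℂ) : slicePointL I z = slicePoint I z := rfl

/-- The real-linear map `w ↦ slicePoint I w * v`, linear in `v`. -/
def sliceMulL (I : ℍ[ℝ]) : ℍ[ℝ] →L[ℝ] ℂ →L[ℝ] ℍ[ℝ] :=
  ((ContinuousLinearMap.compL ℝ ℂ ℍ[ℝ] ℍ[ℝ]).flip (slicePointL I)).comp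
    (ContinuousLinearMap.mul ℝ ℍ[ℝ]).flip

@[simp] theorem sliceMulL_apply (I v : ℍ[ℝ]) (w : ℂ) : sliceMulL I v w = slicePoint I w * v := rfl

theorem norm_sliceMulL_le {I : ℍ[ℝ]} (hI : I ∈ imagUnits) (v : ℍ[ℝ]) : ‖sliceMulL I v‖ ≤ ‖v‖ := by
  refine ContinuousLinearMap.opNorm_le_bound _ (norm_nonneg v) fun w => ?_
  rw [sliceMulL_apply, norm_mul, norm_slicePoint hI, mul_comm]

theorem hasFDerivAt_leftEval_slicePoint {φ : ℍ[ℝ]⟦X⟧} (hφ : DiscSummable φ) {I : ℍ[ℝ]}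
    (hI : I ∈ imagUnits) {z : ℂ} (hz : ‖z‖ < 1) :
    HasFDerivAt (fun w => leftEval φ (slicePoint I w))
      (sliceMulL I (leftEval (derivSeries φ) (slicePoint I z))) z := by
  -- At `n = 0` the truncated exponent is harmless, since the factor `n` vanishes.
  set v : ℕ → ℂ → ℍ[ℝ] := fun n w => slicePoint I w ^ (n - 1) * ((n : ℝ) • coeff n φ) with hv
  have hshift : ∀ (n : ℕ) w, v (n + 1) w = slicePoint I w ^ n * coeff n (derivSeries φ) := by
    intro n w
    simp [hv]
  have hvs : HasSum (fun n => v n z) (leftEval (derivSeries φ) (slicePoint I z)) := by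
    have h1 := hφ.derivSeries.hasSum (q := slicePoint I z) (by rwa [norm_slicePoint hI])
    rw [← hasSum_nat_add_iff' 1]
    simpa [hv] using hasSum_of_eq h1 fun n => hshift n z
  rw [← hvs.tsum_eq, ContinuousLinearMap.map_tsum _ hvs.summable]
  obtain ⟨r, hzr, hr1⟩ := exists_between hz
  have hr0 : 0 ≤ r := (norm_nonneg z).trans hzr.le
  refine hasFDerivAt_tsum_of_isPreconnected (u := fun n : ℕ => ‖(n : ℝ) • coeff n φ‖ * r ^ (n - 1))
    (f := fun (n : ℕ) w => slicePoint I w ^ n * coeff n φ) (f' := fun (n : ℕ) w => sliceMulL I (v n w))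
    (s := Metric.ball 0 r) (x₀ := z) ?_ Metric.isOpen_ball
    (convex_ball 0 r).isPreconnected (fun n w _ => ?_) (fun n w hw => ?_) (by simpa using hzr)
    (hφ.hasSum (by rwa [norm_slicePoint hI])).summable (by simpa using hzr)
  · rw [← summable_nat_add_iff 1]
    refine (hφ.derivSeries r hr0 hr1).congr fun n => ?_
    simp
  · have h1 : HasFDerivAt (fun w : ℂ => w ^ n)
        (((ContinuousLinearMap.toSpanSingleton ℂ ((n : ℂ) * w ^ (n - 1))).restrictScalars ℝ)) w :=
      (hasDerivAt_pow n w).hasFDerivAt.restrictScalars ℝ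
    have h2 := (((slicePointL I).hasFDerivAt (x := w ^ n)).comp w h1).mul_const' (coeff n φ)
    have e : (fun w => slicePoint I w ^ n * coeff n φ) =
        fun w => (slicePointL I ∘ fun w : ℂ => w ^ n) w * coeff n φ := by
      funext w
      simp [slicePoint_pow hI]
    rw [e]
    refine HasFDerivAt.congr_fderiv h2 ?_
    ext1 x
    have e2 : slicePoint I (n : ℂ) = ((n : ℝ) : ℍ[ℝ]) := by
      rw [← slicePoint_ofReal I]; simp
    simp only [hv, sliceMulL_apply, smul_apply, ContinuousLinearMap.comp_apply,
      ContinuousLinearMap.coe_restrictScalars', ContinuousLinearMap.toSpanSingleton_apply,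
      slicePointL_apply, smul_eq_mul, slicePoint_mul hI, slicePoint_pow hI, e2,
      MulOpposite.smul_eq_mul_unop, MulOpposite.unop_op]
    rw [Quaternion.coe_mul_eq_smul]
    simp only [mul_smul_comm, smul_mul_assoc, mul_assoc]
  · refine (norm_sliceMulL_le hI _).trans ?_
    simp only [hv]
    rw [norm_mul, norm_pow, norm_slicePoint hI, mul_comm]
    rw [mem_ball_zero_iff] at hw
    gcongr

/-- The slice derivative of a power series is computed termwise. -/
theorem sliceDeriv_eq_leftEval {f : ℍ[ℝ] → ℍ[ℝ]} {φ : ℍ[ℝ]⟦X⟧} (hφ : DiscSummable φ)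
    (hf : ∀ q : ℍ[ℝ], ‖q‖ < 1 → f q = leftEval φ q) {q : ℍ[ℝ]} (hq : ‖q‖ < 1) :
    sliceDeriv f q = leftEval (derivSeries φ) q := by
  have hI := unitOf_mem_imagUnits q
  set I := unitOf q with hI'
  set z : ℂ := ⟨q.re, ‖q.im‖⟩ with hz
  have hqz : slicePoint I z = q := slicePoint_unitOf q
  have hz1 : ‖z‖ < 1 := by rw [hz, norm_complex_of]; exact hq
  have h := hasFDerivAt_leftEval_slicePoint hφ hI hz1
  have he : sliceRestrict f I =ᶠ[nhds z] fun w => leftEval φ (slicePoint I w) := by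
    filter_upwards [Metric.isOpen_ball.mem_nhds (show z ∈ Metric.ball 0 1 by simpa using hz1)]
      with w hw
    exact hf _ (by rw [norm_slicePoint hI]; simpa using hw)
  have h' := (h.congr_of_eventuallyEq he).fderiv
  rw [sliceDeriv, ← hI', ← hz, derivI, partialX, partialY, h', hqz, sliceMulL_apply,
    sliceMulL_apply, slicePoint_I, ← mul_assoc, mul_self_of_mem_imagUnits hI]
  have : slicePoint I 1 = 1 := by simp [slicePoint]
  rw [this, one_mul, neg_one_mul, sub_neg_eq_add, ← two_smul ℝ, smul_smul]
  norm_num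

/-! ### Power series expansion of slice regular functions -/

theorem mem_unitBall {q : ℍ[ℝ]} : q ∈ unitBall ↔ ‖q‖ < 1 := by
  simp [unitBall]

/-- The Cauchy–Riemann equation says `∂_y = I ∂_x`, so the differential is linear over `ℂ_I` acting
from the left. -/
theorem fderiv_sliceRestrict_apply {f : ℍ[ℝ] → ℍ[ℝ]} {Ω : Set ℍ[ℝ]} (hf : SliceRegularOn f Ω)
    {I : ℍ[ℝ]} (hI : I ∈ imagUnits) {z : ℂ} (hz : slicePoint I z ∈ Ω) (w : ℂ) :
    fderiv ℝ (sliceRestrict f I) z w = slicePoint I w * partialX f I z := by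
  have h := (hf I hI).2 z hz
  have h' : partialX f I z + I * partialY f I z = 0 := by
    rw [smul_eq_zero] at h
    exact h.resolve_left (by norm_num)
  have hy : partialY f I z = I * partialX f I z := by
    have := congrArg (fun q => I * q) h'
    simp only [mul_add, mul_zero, ← mul_assoc, mul_self_of_mem_imagUnits hI, neg_one_mul] at this
    exact (eq_of_sub_eq_zero (by rw [sub_eq_add_neg]; exact this)).symm
  have hw : w = w.re • (1 : ℂ) + w.im • Complex.I := by
    apply Complex.ext <;> simp
  conv_lhs => rw [hw, map_add, map_smul, map_smul]
  change w.re • partialX f I z + w.im • partialY f I z = _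
  rw [hy, slicePoint, add_mul, Quaternion.coe_mul_eq_smul, Quaternion.coe_mul_eq_smul,
    smul_mul_assoc]

theorem exists_expansion_on_slice {f : ℍ[ℝ] → ℍ[ℝ]} (hf : SliceRegularOn f unitBall) {I : ℍ[ℝ]}
    (hI : I ∈ imagUnits) : ∃ c : ℕ → ℍ[ℝ], ∀ z : ℂ, ‖z‖ < 1 →
      HasSum (fun n => slicePoint I z ^ n * c n) (f (slicePoint I z)) := by
  set F := sliceRestrict f I with hF
  -- This estimate is the bridge from real to complex differentiability: it remains the same under
  -- the complex structure below.
  have hlit : ∀ z : ℂ, ‖z‖ < 1 →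
      (fun w => F w - F z - slicePoint I (w - z) * partialX f I z) =o[nhds z] fun w => w - z := by
    intro z hz
    have ho : IsOpen {z | slicePoint I z ∈ unitBall} :=
      Metric.isOpen_ball.preimage (continuous_slicePoint I)
    have hz' : slicePoint I z ∈ unitBall := by rwa [mem_unitBall, norm_slicePoint hI]
    have hd := ((hf I hI).1.differentiableOn one_ne_zero).differentiableAt (ho.mem_nhds hz')
    have := hasFDerivAt_iff_isLittleO.1 hd.hasFDerivAt
    simpa only [fderiv_sliceRestrict_apply hf hI hz'] using this
  -- Left multiplication by `ℂ_I` makes the quaternions a complex normed space in which `f_I` is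
  -- holomorphic, so the Taylor theorem for vector-valued functions applies.
  let _ : Module ℂ ℍ[ℝ] :=
    { smul := fun z v => slicePoint I z * v
      one_smul := fun v => by
        change slicePoint I 1 * v = v
        simp [slicePoint]
      mul_smul := fun z w v => by
        change slicePoint I (z * w) * v = slicePoint I z * (slicePoint I w * v)
        rw [slicePoint_mul hI, mul_assoc]
      smul_zero := fun z => mul_zero (slicePoint I z)
      smul_add := fun z v w => mul_add (slicePoint I z) v w
      add_smul := fun z w v => by
        change slicePoint I (z + w) * v = slicePoint I z * v + slicePoint I w * v
        rw [slicePoint_add, add_mul]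
      zero_smul := fun v => by
        change slicePoint I 0 * v = 0
        simp [slicePoint] }
  let _ : NormedSpace ℂ ℍ[ℝ] :=
    { norm_smul_le := fun z v => by
        change ‖slicePoint I z * v‖ ≤ _
        rw [norm_mul, norm_slicePoint hI] }
  have hsmul : ∀ (z : ℂ) (v : ℍ[ℝ]), z • v = slicePoint I z * v := fun _ _ => rfl
  have hd : DifferentiableOn ℂ F (Metric.ball 0 1) := by
    intro z hz
    have : HasDerivAt F (partialX f I z) z := hasDerivAt_iff_isLittleO.2 (hlit z (by simpa using hz))
    exact this.differentiableAt.differentiableWithinAt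
  refine ⟨fun n => (n.factorial : ℂ)⁻¹ • iteratedDeriv n F 0, fun z hz => ?_⟩
  refine hasSum_of_eq (Complex.hasSum_taylorSeries_on_ball hd (z := z) (by simpa using hz))
    fun n => ?_
  rw [sub_zero, ← slicePoint_pow hI, ← hsmul, smul_comm]

/-- A slice regular function on the ball is the sum of a power series. -/
theorem exists_expansion {f : ℍ[ℝ] → ℍ[ℝ]} (hf : SliceRegularOn f unitBall) :
    ∃ φ : ℍ[ℝ]⟦X⟧, DiscSummable φ ∧ ∀ q : ℍ[ℝ], ‖q‖ < 1 → f q = leftEval φ q := by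
  choose c hc using fun I : imagUnits => exists_expansion_on_slice hf I.2
  have hreal : ∀ (I : imagUnits) (t : ℝ), |t| < 1 → HasSum (fun n => t ^ n • c I n) (f (t : ℍ[ℝ])) := by
    intro I t ht
    have := hc I t (by simpa using ht)
    rw [slicePoint_ofReal] at this
    refine hasSum_of_eq this fun n => ?_
    rw [← Quaternion.coe_pow, Quaternion.coe_mul_eq_smul]
  set I₀ : imagUnits := ⟨basisI, basisI_mem_imagUnits⟩
  -- All planes share the real axis, where the values of `f` determine the coefficients.
  have heq : ∀ I, c I = c I₀ := fun I => coeff_unique (g := fun t => f (t : ℍ[ℝ])) (hreal I) (hreal I₀)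
  have hsum : ∀ q : ℍ[ℝ], ‖q‖ < 1 → HasSum (fun n => q ^ n * coeff n (PowerSeries.mk (c I₀))) (f q) := by
    intro q hq
    obtain ⟨I, hI, z, rfl, hz⟩ := exists_slicePoint q
    have := hc ⟨I, hI⟩ z (by rwa [hz])
    rw [heq] at this
    simpa using this
  refine ⟨PowerSeries.mk (c I₀), discSummable_of_summable fun r h0 h1 => ⟨(r : ℍ[ℝ]), ?_, ?_⟩,
    fun q hq => (hsum q hq).tsum_eq.symm⟩
  · simpa using h0
  · exact (hsum _ (by simpa [abs_of_nonneg h0] using h1)).summable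

theorem eq_of_leftEval_eq {φ ψ : ℍ[ℝ]⟦X⟧} (hφ : DiscSummable φ) (hψ : DiscSummable ψ)
    (h : ∀ q : ℍ[ℝ], ‖q‖ < 1 → leftEval φ q = leftEval ψ q) : φ = ψ := by
  have key : ∀ χ : ℍ[ℝ]⟦X⟧, DiscSummable χ → ∀ t : ℝ, |t| < 1 →
      HasSum (fun n => t ^ n • coeff n χ) (leftEval χ (t : ℍ[ℝ])) := by
    intro χ hχ t ht
    refine hasSum_of_eq (hχ.hasSum (q := (t : ℍ[ℝ])) (by simpa using ht)) fun n => ?_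
    rw [← Quaternion.coe_pow, Quaternion.coe_mul_eq_smul]
  have := coeff_unique (g := fun t => leftEval φ (t : ℍ[ℝ])) (key φ hφ) fun t ht => by
    rw [h _ (by simpa using ht)]
    exact key ψ hψ t ht
  ext1 n
  exact congrFun this n

/-! ### Regular operations on power series -/

theorem iterate_sliceDeriv_zero (n : ℕ) {f : ℍ[ℝ] → ℍ[ℝ]} {φ : ℍ[ℝ]⟦X⟧} (hφ : DiscSummable φ)
    (hf : ∀ q : ℍ[ℝ], ‖q‖ < 1 → f q = leftEval φ q) :
    (sliceDeriv^[n] f) 0 = (n.factorial : ℝ) • coeff n φ := by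
  induction n generalizing f φ with
  | zero => simp [hf 0, leftEval_zero]
  | succ n ih =>
    rw [Function.iterate_succ_apply,
      ih hφ.derivSeries (fun q hq => sliceDeriv_eq_leftEval hφ hf hq), coeff_derivSeries, smul_smul,
      Nat.factorial_succ]
    congr 1
    push_cast
    ring

theorem taylorCoeff_eq {f : ℍ[ℝ] → ℍ[ℝ]} {φ : ℍ[ℝ]⟦X⟧} (hφ : DiscSummable φ)
    (hf : ∀ q : ℍ[ℝ], ‖q‖ < 1 → f q = leftEval φ q) (n : ℕ) : taylorCoeff f n = coeff n φ := by
  rw [taylorCoeff, iterate_sliceDeriv_zero n hφ hf, smul_smul,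
    inv_mul_cancel₀ (by exact_mod_cast n.factorial_ne_zero), one_smul]

theorem regMul_eq {f g : ℍ[ℝ] → ℍ[ℝ]} {φ ψ : ℍ[ℝ]⟦X⟧} (hφ : DiscSummable φ) (hψ : DiscSummable ψ)
    (hf : ∀ q : ℍ[ℝ], ‖q‖ < 1 → f q = leftEval φ q)
    (hg : ∀ q : ℍ[ℝ], ‖q‖ < 1 → g q = leftEval ψ q) : regMul f g = leftEval (φ * ψ) := by
  funext q
  rw [regMul, leftEval]
  refine tsum_congr fun n => ?_
  rw [coeff_mul, Finset.Nat.sum_antidiagonal_eq_sum_range_succ fun i j => coeff i φ * coeff j ψ]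
  simp only [taylorCoeff_eq hφ hf, taylorCoeff_eq hψ hg]

theorem regConj_eq {f : ℍ[ℝ] → ℍ[ℝ]} {φ : ℍ[ℝ]⟦X⟧} (hφ : DiscSummable φ)
    (hf : ∀ q : ℍ[ℝ], ‖q‖ < 1 → f q = leftEval φ q) : regConj f = leftEval (conjSeries φ) := by
  funext q
  rw [regConj, leftEval]
  simp only [taylorCoeff_eq hφ hf, coeff_conjSeries]

/-- Multiplying `φ * ψ = 1` by the conjugate series gives `f^c = f^s * ψ`. The value `f^s(q)`
commutes with `q`, so this product is evaluated pointwise. -/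
theorem regInv_eq {f : ℍ[ℝ] → ℍ[ℝ]} {φ ψ : ℍ[ℝ]⟦X⟧} (hφ : DiscSummable φ) (hψ : DiscSummable ψ)
    (hf : ∀ q : ℍ[ℝ], ‖q‖ < 1 → f q = leftEval φ q)
    (hne : ∀ q : ℍ[ℝ], ‖q‖ < 1 → f q ≠ 0) (hinv : φ * ψ = 1) {q : ℍ[ℝ]} (hq : ‖q‖ < 1) :
    regInv f q = leftEval ψ q := by
  have hne' : ∀ q : ℍ[ℝ], ‖q‖ < 1 → leftEval φ q ≠ 0 := fun q hq => hf q hq ▸ hne q hq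
  have hc := hφ.conjSeries
  have h1 : symmetrization f = leftEval (φ * conjSeries φ) := by
    rw [symmetrization, regConj_eq hφ hf]
    exact regMul_eq hφ hc hf fun _ _ => rfl
  have h2 : leftEval (conjSeries φ) q = leftEval (φ * conjSeries φ) q * leftEval ψ q := by
    rw [← leftEval_mul_of_commute (hφ.mul hc) hψ hq (commute_leftEval_mul_conjSeries hφ hq),
      ← conjSeries_mul_self, mul_assoc, hinv, mul_one]
  rw [regInv, h1, regConj_eq hφ hf, h2,
    inv_mul_cancel_left₀ (leftEval_mul_conjSeries_ne_zero hφ hne' hq)]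

/-- The power series `∑ qⁿ n uⁿ⁻¹` of the Koebe function. -/
def koebeSeries (u : ℍ[ℝ]) : ℍ[ℝ]⟦X⟧ := PowerSeries.mk fun n => (n : ℝ) • u ^ (n - 1)

theorem discSummable_koebeSeries {u : ℍ[ℝ]} (hu : ‖u‖ = 1) : DiscSummable (koebeSeries u) := by
  refine discSummable_of_norm_le (a := fun _ => 1) 1 (fun r h0 h1 => ?_) (fun _ => zero_le_one)
    fun n => ?_
  · simpa using summable_geometric_of_lt_one h0 h1
  · rw [koebeSeries, coeff_mk, norm_smul, norm_pow, hu]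
    simp

/-- The regular reciprocal of `1 - qu` is the geometric series `∑ qⁿ uⁿ`, whose square has
coefficients `(n+1)uⁿ`. -/
theorem koebe_eq_leftEval {u : ℍ[ℝ]} (hu : ‖u‖ = 1) {q : ℍ[ℝ]} (hq : ‖q‖ < 1) :
    koebe u q = leftEval (koebeSeries u) q := by
  set P : ℍ[ℝ]⟦X⟧ := 1 - PowerSeries.C u * PowerSeries.X with hP
  set G : ℍ[ℝ]⟦X⟧ := PowerSeries.mk fun n => u ^ n with hG
  have hgeom : ∀ r : ℝ, 0 ≤ r → r < 1 → Summable fun n => (fun _ : ℕ => (2 : ℝ)) n * r ^ n :=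
    fun r h0 h1 => (summable_geometric_of_lt_one h0 h1).mul_left 2
  have hP0 : coeff 0 P = 1 := by simp [hP]
  have hP1 : coeff 1 P = -u := by simp [hP, coeff_one]
  have hP2 : ∀ n, coeff (n + 2) P = 0 := by
    intro n
    simp [hP, coeff_one]
  have hPs : DiscSummable P := by
    refine discSummable_of_norm_le 0 hgeom (fun _ => zero_le_two) fun n => ?_
    match n with
    | 0 => simp [hP0]
    | 1 => simp [hP1, hu]
    | n + 2 => simp [hP2]
  have hGs : DiscSummable G := by
    refine discSummable_of_norm_le 0 hgeom (fun _ => zero_le_two) fun n => ?_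
    simp [hG, hu]
  have hPG : P * G = 1 := by
    ext1 n
    rw [hP, sub_mul, one_mul, map_sub, mul_assoc, coeff_C_mul]
    cases n with
    | zero => simp [hG]
    | succ n =>
      rw [coeff_succ_X_mul]
      simp [hG, coeff_one, pow_succ']
  have hPe : ∀ q : ℍ[ℝ], ‖q‖ < 1 → (1 : ℍ[ℝ]) - q * u = leftEval P q := by
    intro q _
    rw [leftEval, tsum_eq_sum (s := Finset.range 2)]
    · simp [Finset.sum_range_succ, hP0, hP1, sub_eq_add_neg]
    · intro n hn
      obtain ⟨m, rfl⟩ := Nat.exists_eq_add_of_le' (not_lt.1 (mt Finset.mem_range.2 hn))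
      rw [hP2, mul_zero]
  have hne : ∀ q : ℍ[ℝ], ‖q‖ < 1 → (1 : ℍ[ℝ]) - q * u ≠ 0 := by
    intro q hq h0
    have := congrArg norm (sub_eq_zero.1 h0)
    rw [norm_mul, hu, norm_one, mul_one] at this
    exact hq.ne this.symm
  have hinv : ∀ q : ℍ[ℝ], ‖q‖ < 1 → regInv (fun p => 1 - p * u) q = leftEval G q :=
    fun q hq => regInv_eq hPs hGs hPe hne hPG hq
  rw [koebe, regMul_eq hGs hGs hinv hinv]
  have h1 := ((hGs.mul hGs).hasSum hq).mul_left q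
  refine h1.unique ?_
  have h2 := (discSummable_koebeSeries hu).hasSum hq
  rw [← hasSum_nat_add_iff' 1] at h2
  have h3 : leftEval (koebeSeries u) q - ∑ i ∈ Finset.range 1, q ^ i * coeff i (koebeSeries u) =
      leftEval (koebeSeries u) q := by
    simp [koebeSeries]
  rw [h3] at h2
  refine hasSum_of_eq h2 fun n => ?_
  rw [← mul_assoc, pow_succ', coeff_mul]
  congr 1
  rw [Finset.sum_congr rfl (g := fun _ => u ^ n) fun p hp => by
    rw [hG, coeff_mk, coeff_mk, ← pow_add, mem_antidiagonal.1 hp]]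
  rw [Finset.sum_const, Finset.Nat.card_antidiagonal, koebeSeries, coeff_mk, Nat.add_sub_cancel,
    Nat.cast_smul_eq_nsmul]

/-! ### Coefficient estimates -/

theorem sum_two_mul_succ (n : ℕ) : ∑ i ∈ Finset.range n, ((i : ℝ) + 1) * 2 = n * (n + 1) := by
  induction n with
  | zero => simp
  | succ n ih =>
    rw [Finset.sum_range_succ, ih]
    push_cast
    ring

/-- The range may stop before `N` so that the last terms can be split off when equality is analysed.
-/
theorem norm_convolution_le {b p : ℕ → ℍ[ℝ]} {n N : ℕ} (hn : n ≤ N)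
    (hb : ∀ i < n, ‖b i‖ ≤ i + 1) (hp : ∀ j, j ≠ 0 → ‖p j‖ ≤ 2) :
    ‖∑ i ∈ Finset.range n, b i * p (N - i)‖ ≤ n * (n + 1) := by
  rw [← sum_two_mul_succ]
  refine norm_sum_le_of_le _ fun i hi => ?_
  have hi := Finset.mem_range.1 hi
  rw [norm_mul]
  have h1 := hb i hi
  have h2 := hp (N - i) (by omega)
  gcongr

theorem convolution_geometric {b p : ℕ → ℍ[ℝ]} {u : ℍ[ℝ]} {n : ℕ}
    (hb : ∀ i < n, b i = ((i : ℝ) + 1) • u ^ i) (hp : ∀ j, j ≠ 0 → p j = 2 * u ^ j) :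
    ∑ i ∈ Finset.range n, b i * p (n - i) = ((n : ℝ) * (n + 1)) • u ^ n := by
  rw [← sum_two_mul_succ, Finset.sum_smul]
  refine Finset.sum_congr rfl fun i hi => ?_
  have hi := Finset.mem_range.1 hi
  rw [hb i hi, hp (n - i) (by omega), mul_smul, two_mul, two_smul, smul_mul_assoc, mul_add,
    ← pow_add, Nat.add_sub_cancel' hi.le]

theorem coeff_derivSeries_of_eq_mul {φ k p : ℍ[ℝ]⟦X⟧} (h : derivSeries φ = k * p)
    (hp0 : coeff 0 p = 1) (n : ℕ) :
    ((n : ℝ) + 1) • coeff (n + 1) φ =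
      ∑ i ∈ Finset.range n, coeff i k * coeff (n - i) p + coeff n k := by
  rw [← coeff_derivSeries, h, coeff_mul,
    Finset.Nat.sum_antidiagonal_eq_sum_range_succ fun i j => coeff i k * coeff j p,
    Finset.sum_range_succ, Nat.sub_self, hp0, mul_one]

/-- Equality in the triangle inequality for unit vectors. -/
theorem eq_of_add_le_norm_smul_add {E : Type*} [NormedAddCommGroup E] [InnerProductSpace ℝ E]
    {u v : E} (hu : ‖u‖ = 1) (hv : ‖v‖ = 1) {s t : ℝ} (hs : 0 < s) (ht : 0 < t)
    (h : s + t ≤ ‖s • u + t • v‖) : u = v := by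
  have h1 := norm_add_sq_real (s • u) (t • v)
  rw [norm_smul, norm_smul, hu, hv, Real.norm_of_nonneg hs.le, Real.norm_of_nonneg ht.le,
    real_inner_smul_left, real_inner_smul_right] at h1
  have h2 : (s + t) ^ 2 ≤ ‖s • u + t • v‖ ^ 2 := by gcongr
  have h3 : 1 ≤ inner ℝ u v := by
    have : 0 ≤ (s * t) * (inner ℝ u v - 1) := by nlinarith
    linarith [nonneg_of_mul_nonneg_right this (mul_pos hs ht)]
  have h4 := norm_sub_sq_real u v
  rw [hu, hv] at h4
  have h5 : ‖u - v‖ ^ 2 ≤ 0 := by linarith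
  exact sub_eq_zero.1 (norm_eq_zero.1 (pow_eq_zero_iff two_ne_zero |>.1
    (le_antisymm h5 (sq_nonneg _))))

section Coefficients

/-- `k(q) = q⁻¹ h(q)` for a regular starlike `h`, in terms of power series: `h' = k * p` where
`p(0) = 1` and `p` has positive real part. -/
structure IsStarlikePair (k p : ℍ[ℝ]⟦X⟧) : Prop where
  coeff_zero : coeff 0 k = 1
  discSummable : DiscSummable p
  coeff_zero_right : coeff 0 p = 1
  re_pos : ∀ q : ℍ[ℝ], ‖q‖ < 1 → 0 < (leftEval p q).re
  smul_coeff : ∀ n : ℕ, (n : ℝ) • coeff n k = ∑ i ∈ Finset.range n, coeff i k * coeff (n - i) p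

variable {k p : ℍ[ℝ]⟦X⟧}

theorem IsStarlikePair.norm_coeff_le (h : IsStarlikePair k p) (n : ℕ) : ‖coeff n k‖ ≤ n + 1 := by
  induction n using Nat.strong_induction_on with
  | _ n ih =>
    rcases Nat.eq_zero_or_pos n with rfl | hn
    · simp [h.coeff_zero]
    · have h1 := norm_convolution_le le_rfl ih fun j hj =>
        norm_coeff_le_two h.discSummable h.coeff_zero_right h.re_pos hj
      rw [← h.smul_coeff, norm_smul, Real.norm_of_nonneg (Nat.cast_nonneg n)] at h1
      exact le_of_mul_le_mul_left h1 (by exact_mod_cast hn)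

/-- All terms but the last in the recursion for `k_{m+1}` contribute at most `m(m+1)`, so
`(m+1)|p_1| ≥ 2(m+1)`. Once `p_j = 2v^j`, the recursion determines `k`. -/
theorem IsStarlikePair.coeff_eq (h : IsStarlikePair k p) {m : ℕ} (hm : (m : ℝ) + 2 ≤ ‖coeff (m + 1) k‖) :
    ∃ v : ℍ[ℝ], ‖v‖ = 1 ∧ ∀ n, coeff n k = ((n : ℝ) + 1) • v ^ n := by
  have hp2 : ∀ j, j ≠ 0 → ‖coeff j p‖ ≤ 2 := fun j hj =>
    norm_coeff_le_two h.discSummable h.coeff_zero_right h.re_pos hj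
  have h1 : ‖coeff 1 p‖ = 2 := by
    refine le_antisymm (hp2 1 one_ne_zero) ?_
    have e := congrArg norm (h.smul_coeff (m + 1))
    rw [norm_smul, Real.norm_of_nonneg (Nat.cast_nonneg _), Finset.sum_range_succ,
      Nat.add_sub_cancel_left] at e
    have h2 := norm_convolution_le (N := m + 1) (Nat.le_succ m) (fun i _ => h.norm_coeff_le i) hp2
    have h3 := norm_add_le (∑ i ∈ Finset.range m, coeff i k * coeff (m + 1 - i) p)
      (coeff m k * coeff 1 p)
    rw [norm_mul] at h3
    have h4 : ‖coeff m k‖ * ‖coeff 1 p‖ ≤ (m + 1) * ‖coeff 1 p‖ := by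
      gcongr
      exact h.norm_coeff_le m
    push_cast at e
    have h5 : ((m : ℝ) + 1) * (m + 2) ≤ (m + 1) * ‖coeff (m + 1) k‖ := by gcongr
    have h6 : ((m : ℝ) + 1) * 2 ≤ (m + 1) * ‖coeff 1 p‖ := by linarith
    exact le_of_mul_le_mul_left h6 (by positivity)
  obtain ⟨v, hv, hpv⟩ :=
    coeff_eq_of_norm_coeff_one h.discSummable h.coeff_zero_right h.re_pos h1
  refine ⟨v, hv, fun n => ?_⟩
  induction n using Nat.strong_induction_on with
  | _ n ih =>
    rcases Nat.eq_zero_or_pos n with rfl | hn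
    · simp [h.coeff_zero]
    · have h2 := h.smul_coeff n
      rw [convolution_geometric ih hpv, mul_smul] at h2
      exact smul_right_injective _ (by exact_mod_cast hn.ne') h2

variable {φ g : ℍ[ℝ]⟦X⟧}

/-- The terms with `i < n` contribute at most `n(n+1)` and the last one at most `n + 1`, in total
`(n+1)²`. -/
theorem IsStarlikePair.norm_coeff_closeToConvex_le (h : IsStarlikePair k p) (hg : DiscSummable g)
    (hg0 : coeff 0 g = 1) (hpos : ∀ q : ℍ[ℝ], ‖q‖ < 1 → 0 < (leftEval g q).re)
    (hφ : derivSeries φ = k * g) (n : ℕ) : ‖coeff (n + 1) φ‖ ≤ n + 1 := by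
  have e := congrArg norm (coeff_derivSeries_of_eq_mul hφ hg0 n)
  rw [norm_smul, Real.norm_of_nonneg (by positivity)] at e
  have h1 := norm_convolution_le (N := n) le_rfl (fun i _ => h.norm_coeff_le i) fun j hj =>
    norm_coeff_le_two hg hg0 hpos hj
  have h2 := norm_add_le (∑ i ∈ Finset.range n, coeff i k * coeff (n - i) g) (coeff n k)
  have h3 := h.norm_coeff_le n
  have h4 : ((n : ℝ) + 1) * ‖coeff (n + 1) φ‖ ≤ (n + 1) * (n + 1) := by linarith
  exact le_of_mul_le_mul_left h4 (by positivity)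

theorem IsStarlikePair.eq_koebeSeries (h : IsStarlikePair k p) (hg : DiscSummable g)
    (hg0 : coeff 0 g = 1) (hpos : ∀ q : ℍ[ℝ], ‖q‖ < 1 → 0 < (leftEval g q).re)
    (hφ : derivSeries φ = k * g) (hφ0 : coeff 0 φ = 0) {m : ℕ}
    (hm : ‖coeff (m + 2) φ‖ = m + 2) : ∃ u : ℍ[ℝ], ‖u‖ = 1 ∧ φ = koebeSeries u := by
  have hg2 : ∀ j, j ≠ 0 → ‖coeff j g‖ ≤ 2 := fun j hj => norm_coeff_le_two hg hg0 hpos hj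
  have e := congrArg norm (coeff_derivSeries_of_eq_mul hφ hg0 (m + 1))
  rw [norm_smul, Real.norm_of_nonneg (by positivity), Finset.sum_range_succ,
    Nat.add_sub_cancel_left, show m + 1 + 1 = m + 2 from rfl, hm, add_assoc] at e
  have h2 := norm_convolution_le (N := m + 1) (Nat.le_succ m) (fun i _ => h.norm_coeff_le i) hg2
  have h3 := norm_add_le (∑ i ∈ Finset.range m, coeff i k * coeff (m + 1 - i) g)
      (coeff m k * coeff 1 g + coeff (m + 1) k)
  -- The two top terms must supply at least `(m+2)² - m(m+1) = 2(m+1) + (m+2)`, which is the sum of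
  -- their separate maxima.
  have hlow : 2 * ((m : ℝ) + 1) + (m + 2) ≤ ‖coeff m k * coeff 1 g + coeff (m + 1) k‖ := by
    push_cast at e
    nlinarith
  have h4 := norm_add_le (coeff m k * coeff 1 g) (coeff (m + 1) k)
  rw [norm_mul] at h4
  have hk1 := h.norm_coeff_le (m + 1)
  push_cast at hk1
  have hkm := h.norm_coeff_le m
  have hg1 := hg2 1 one_ne_zero
  have h5 : ‖coeff m k‖ * ‖coeff 1 g‖ ≤ (m + 1) * ‖coeff 1 g‖ := by gcongr
  have h6 : ((m : ℝ) + 1) * ‖coeff 1 g‖ ≤ (m + 1) * 2 := by gcongr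
  obtain ⟨v, hv, hkv⟩ := h.coeff_eq (m := m) (by linarith)
  have hg1' : ‖coeff 1 g‖ = 2 := by
    refine le_antisymm hg1 ?_
    have h7 : ((m : ℝ) + 1) * 2 ≤ (m + 1) * ‖coeff 1 g‖ := by linarith
    exact le_of_mul_le_mul_left h7 (by positivity)
  obtain ⟨u, hu, hgu⟩ := coeff_eq_of_norm_coeff_one hg hg0 hpos hg1'
  have huv : u = v := by
    refine eq_of_add_le_norm_smul_add hu hv (s := 2 * ((m : ℝ) + 1)) (t := m + 2) (by positivity)
      (by positivity) (hlow.trans (le_of_eq ?_))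
    -- Factoring out the unit-norm `v^m` leaves a positive combination of `u` and `v`.
    have : coeff m k * coeff 1 g + coeff (m + 1) k =
        v ^ m * ((2 * ((m : ℝ) + 1)) • u + ((m : ℝ) + 2) • v) := by
      rw [hkv, hkv, hgu 1 one_ne_zero, mul_add, pow_one, two_mul, mul_comm (2 : ℝ), mul_smul,
        two_smul, mul_smul_comm, smul_mul_assoc, mul_smul_comm, ← pow_succ]
      congr 2
      push_cast
      ring
    rw [this, norm_mul, norm_pow, hv, one_pow, one_mul]
  subst huv
  refine ⟨u, hu, ?_⟩
  ext1 n
  rw [koebeSeries, coeff_mk]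
  cases n with
  | zero => simp [hφ0]
  | succ n =>
    have h1 := coeff_derivSeries_of_eq_mul hφ hg0 n
    rw [convolution_geometric (fun i _ => hkv i) hgu, hkv, ← add_smul] at h1
    have hn : ((n : ℝ) + 1) ≠ 0 := by positivity
    refine smul_right_injective _ hn ?_
    simp only
    rw [h1, smul_smul, Nat.add_sub_cancel]
    congr 1
    push_cast
    ring

end Coefficients

/-! ### The classes `𝒮*` and `𝒞` in terms of power series -/

theorem coeff_zero_eq_one_of_derivSeries_eq {φ k p : ℍ[ℝ]⟦X⟧} (h : derivSeries φ = k * p)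
    (hφ : coeff 1 φ = 1) (hk : coeff 0 k = 1) : coeff 0 p = 1 := by
  have := congrArg (coeff 0) h
  rw [coeff_derivSeries, coeff_mul] at this
  simpa [hφ, hk] using this.symm

/-- The power series data of a function in `𝒮*` and of the functions that are close-to-convex
with respect to it. -/
theorem ClassSStar.exists_isStarlikePair {h : ℍ[ℝ] → ℍ[ℝ]} (hh : ClassSStar h) :
    ∃ k p : ℍ[ℝ]⟦X⟧, IsStarlikePair k p ∧ DiscSummable k ∧
      (∀ q : ℍ[ℝ], ‖q‖ < 1 → leftEval k q ≠ 0) ∧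
      ∀ q : ℍ[ℝ], ‖q‖ < 1 → h q = q * leftEval k q := by
  obtain ⟨⟨hreg, hzero, hderiv⟩, hpos⟩ := hh
  obtain ⟨ψ, hψ, hψe⟩ := exists_expansion hreg
  have hz0 : h 0 = 0 := by
    have : (0 : ℍ[ℝ]) ∈ {q ∈ unitBall | h q = 0} := by rw [hzero]; rfl
    exact this.2
  have hψ0 : coeff 0 ψ = 0 := by
    rw [← leftEval_zero, ← hψe 0 (by simp), hz0]
  have hψ1 : coeff 1 ψ = 1 := by
    have := sliceDeriv_eq_leftEval hψ hψe (q := 0) (by simp)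
    rw [hderiv, leftEval_zero, coeff_derivSeries] at this
    simpa using this.symm
  set k : ℍ[ℝ]⟦X⟧ := PowerSeries.mk fun n => coeff (n + 1) ψ with hk
  have hks : DiscSummable k := discSummable_shift hψ (by simp [hk])
  have hk0 : coeff 0 k = 1 := by simp [hk, hψ1]
  have hhk : ∀ q : ℍ[ℝ], ‖q‖ < 1 → h q = q * leftEval k q := by
    intro q hq
    have h1 := (hks.hasSum hq).mul_left q
    have h2 := hψ.hasSum hq
    rw [← hasSum_nat_add_iff' 1] at h2
    simp only [Finset.range_one, Finset.sum_singleton, hψ0, mul_zero, sub_zero] at h2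
    rw [hψe q hq]
    refine h2.unique (hasSum_of_eq h1 fun n => ?_)
    rw [hk, coeff_mk, pow_succ', mul_assoc]
  -- A zero of `k` is a zero of `h`, hence is the origin, where `k` equals 1.
  have hne : ∀ q : ℍ[ℝ], ‖q‖ < 1 → leftEval k q ≠ 0 := by
    intro q hq h0
    have hq0 : q = 0 := by
      have : q ∈ {q ∈ unitBall | h q = 0} := ⟨mem_unitBall.2 hq, by rw [hhk q hq, h0, mul_zero]⟩
      rwa [hzero] at this
    rw [hq0, leftEval_zero, hk0] at h0
    exact one_ne_zero h0
  have hposk : ∀ q : ℍ[ℝ], ‖q‖ < 1 →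
      0 < ((leftEval k q)⁻¹ * leftEval (derivSeries ψ) q).re := by
    intro q hq
    by_cases hq0 : q = 0
    · rw [hq0, leftEval_zero, leftEval_zero, hk0, coeff_derivSeries, hψ1]
      simp
    · have := hpos q (mem_unitBall.2 hq) hq0
      rwa [hhk q hq, sliceDeriv_eq_leftEval hψ hψe hq, mul_inv_rev, mul_assoc,
        inv_mul_cancel_left₀ hq0] at this
  obtain ⟨p, hp, hkp, hpp⟩ := exists_regular_quotient hks hψ.derivSeries hne hposk
  have hp0 : coeff 0 p = 1 := coeff_zero_eq_one_of_derivSeries_eq hkp hψ1 hk0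
  refine ⟨k, p, ⟨hk0, hp, hp0, hpp, fun n => ?_⟩, hks, hne, hhk⟩
  -- Since `ψ_{n+1} = k_n`, the term `k_n p_0 = k_n` cancels one copy from `(n+1) k_n`, leaving the
  -- recursion for `n k_n`.
  have h1 := coeff_derivSeries_of_eq_mul hkp hp0 n
  have h2 : coeff (n + 1) ψ = coeff n k := by simp [hk]
  rw [h2, add_smul, one_smul] at h1
  exact add_right_cancel h1

theorem ClassC.exists_factorization {f : ℍ[ℝ] → ℍ[ℝ]} (hf : ClassC f) {φ : ℍ[ℝ]⟦X⟧}
    (hφ : DiscSummable φ) (hφe : ∀ q : ℍ[ℝ], ‖q‖ < 1 → f q = leftEval φ q)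
    (hφ1 : coeff 1 φ = 1) : ∃ k p g : ℍ[ℝ]⟦X⟧, IsStarlikePair k p ∧ DiscSummable g ∧
      coeff 0 g = 1 ∧ (∀ q : ℍ[ℝ], ‖q‖ < 1 → 0 < (leftEval g q).re) ∧ derivSeries φ = k * g := by
  obtain ⟨-, h, hh, hpos⟩ := hf
  obtain ⟨k, p, hkp, hks, hne, hhk⟩ := hh.exists_isStarlikePair
  have hposk : ∀ q : ℍ[ℝ], ‖q‖ < 1 →
      0 < ((leftEval k q)⁻¹ * leftEval (derivSeries φ) q).re := by
    intro q hq
    by_cases hq0 : q = 0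
    · rw [hq0, leftEval_zero, leftEval_zero, hkp.coeff_zero, coeff_derivSeries, hφ1]
      simp
    · have := hpos q (mem_unitBall.2 hq) hq0
      rwa [hhk q hq, sliceDeriv_eq_leftEval hφ hφe hq, mul_inv_rev, mul_assoc,
        inv_mul_cancel_left₀ hq0] at this
  obtain ⟨g, hg, hkg, hgp⟩ := exists_regular_quotient hks hφ.derivSeries hne hposk
  exact ⟨k, p, g, hkp, hg, coeff_zero_eq_one_of_derivSeries_eq hkg hφ1 hkp.coeff_zero, hgp, hkg⟩

end SliceReg

end

open SliceReg in
theorem theorem1p2 (f : ℍ[ℝ] → ℍ[ℝ]) (a : ℕ → ℍ[ℝ])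
    (hexp : ∀ q ∈ unitBall, HasSum (fun n : ℕ => q ^ (n + 2) * a (n + 2)) (f q - q))
    (hf : ClassC f) :
    (∀ n : ℕ, 2 ≤ n → ‖a n‖ ≤ n) ∧
    ∀ n : ℕ, 2 ≤ n →
      (‖a n‖ = n ↔ ∃ u : ℍ[ℝ], ‖u‖ = 1 ∧ ∀ q ∈ unitBall, f q = koebe u q) := by
  -- The expansion says nothing about `a 0` and `a 1`, so the coefficients of `q` itself are put
  -- there.
  set φ : ℍ[ℝ]⟦X⟧ := PowerSeries.mk fun n => if n = 0 then 0 else if n = 1 then 1 else a n with hφd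
  have hφ0 : coeff 0 φ = 0 := by simp [hφd]
  have hφ1 : coeff 1 φ = 1 := by simp [hφd]
  have hφ2 : ∀ n, coeff (n + 2) φ = a (n + 2) := fun n => by simp [hφd]
  have hsum : ∀ q : ℍ[ℝ], ‖q‖ < 1 → HasSum (fun n => q ^ n * coeff n φ) (f q) := by
    intro q hq
    rw [← hasSum_nat_add_iff' 2]
    simpa [Finset.sum_range_succ, hφ0, hφ1, hφ2] using hexp q (mem_unitBall.2 hq)
  have hφ : DiscSummable φ := by
    refine discSummable_of_summable fun r h0 h1 => ⟨(r : ℍ[ℝ]), by simpa using h0, ?_⟩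
    exact (hsum _ (by simpa [abs_of_nonneg h0] using h1)).summable
  have hφe : ∀ q : ℍ[ℝ], ‖q‖ < 1 → f q = leftEval φ q := fun q hq => (hsum q hq).tsum_eq.symm
  obtain ⟨k, p, g, hkp, hg, hg0, hgp, hkg⟩ := hf.exists_factorization hφ hφe hφ1
  refine ⟨fun n hn => ?_, fun n hn => ?_⟩
  · obtain ⟨m, rfl⟩ := Nat.exists_eq_add_of_le' hn
    have := hkp.norm_coeff_closeToConvex_le hg hg0 hgp hkg (m + 1)
    rw [show m + 1 + 1 = m + 2 from rfl, hφ2] at this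
    push_cast at this ⊢
    linarith
  · obtain ⟨m, rfl⟩ := Nat.exists_eq_add_of_le' hn
    constructor
    · intro h
      obtain ⟨u, hu, hφu⟩ := hkp.eq_koebeSeries hg hg0 hgp hkg hφ0 (m := m) (by
        rw [hφ2, h]; push_cast; rfl)
      refine ⟨u, hu, fun q hq => ?_⟩
      rw [hφe q (mem_unitBall.1 hq), hφu, koebe_eq_leftEval hu (mem_unitBall.1 hq)]
    · rintro ⟨u, hu, h⟩
      have : φ = koebeSeries u := eq_of_leftEval_eq hφ (discSummable_koebeSeries hu) fun q hq => by
        rw [← hφe q hq, h q (mem_unitBall.2 hq), koebe_eq_leftEval hu hq]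
      rw [← hφ2, this, koebeSeries, coeff_mk, norm_smul, norm_pow, hu, one_pow, mul_one,
        Real.norm_of_nonneg (Nat.cast_nonneg _)]
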